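/- **Setting.** Let $0<\beta<\alpha<1$ be parameters that may depend on $n$, and put $$\rho=\frac{(1-\alpha^2)(1-\beta^2)}{(1-\alpha\beta)^2},\qquad m=\Big\lceil n^{\frac{1-\beta^2}{(1-\alpha\beta)^2}}\Big\rceil ,\qquad \eta=\alpha\sqrt{2\log m}-\sqrt{2(1-\alpha^2)\log\log m}.$$ For a dataset $\mathcal S=\{x_1,\dots,x_n\}\subseteq\mathbb S^{d-1}\subset\mathbb R^d$, the Top-1 data structure draws $m$ independent Gaussian vectors (filters) $a_1,\dots,a_m\sim\mathcal N(0,1)^d$ and stores each $x\in\mathcal S$ in the bucket $i$ (of a hash table with $m$ buckets) that maximizes $\langle a_i,x\rangle$. A query $q\in\mathbb S^{d-1}$ inspects the buckets $i$ with $\langle a_i,q\rangle\ge\eta$, which are found by computing all $m$ inner products; it goes through their points and returns the first $x$ with $\langle q,x\rangle\ge\beta$ that it meets, or "None" if there is none. A point $x\in\mathcal S$ is close if $\langle q,x\rangle\ge\alpha$, and far if $\langle q,x\rangle<\beta$. Time is the number of steps on a unit-cost real RAM (arithmetic, elementary functions, comparisons, memory accesses and the drawing of a standard normal number cost one step each),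 and space is the number of words of the data structure. **Theorem.** Assume that, as $n\to\infty$, $\rho=O(1)$, $$\alpha-\beta=\omega\Big((1-\alpha^2)\Big(\frac{\log\log n}{\log n}\Big)^{1/2}\Big)\qquad\text{and}\qquad 1-\alpha^2=\omega\Big(\frac{\log\log m}{\log m}\Big).$$ Then the preprocessing time of Top-1 is $O(d\,n^{1+\rho/(1-\alpha^2)})$, and its space and its query time are $O(d\,n^{\rho/(1-\alpha^2)})$; these bounds hold for every outcome of the random choices, with absolute constants. Moreover, with $o(1)$ terms that depend only on $n$ and on the sequences $\alpha,\beta$ (not on $d$, $\mathcal S$, $q$), for every $d$, every dataset $\mathcal S$ of $n$ points in $\mathbb S^{d-1}$ and every query $q\in\mathbb S^{d-1}$: * Top-1 solves $(\alpha,\beta)$-ANN with probability $1-o(1)$: if $\mathcal S$ contains a close point, then with probability at least $1-o(1)$ the query returns a point $x\in\mathcal S$ with $\langle q,x\rangle\ge\beta$; * the expected number of buckets that the query inspects is at most $n^{\rho+o(1)}$; * the expected number of far points in the inspected buckets is at most $n^{\rho+o(1)}$; * each close point lies in an inspected bucket with probability at least $1-o(1)$. -/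

import Mathlib

open Filter Topology Asymptotics MeasureTheory ProbabilityTheory

/-! ## A unit-cost real RAM

A computation is a value together with the number of elementary steps spent on it. Programs are
written with the primitives of this section only. Each of them (an arithmetic operation or an
elementary function on reals, a comparison, a memory access, the drawing of one random number)
costs one step; each iteration of a loop costs one further step. -/

/-- A value together with the number of elementary steps spent to compute it. -/
structure Timed (α : Type) where
  val : α
  steps : ℕ

instance : Monad Timed where
  pure a := ⟨a, 0⟩
  bind x f := ⟨(f x.val).val, x.steps + (f x.val).steps⟩

namespace RealRAM

noncomputable section

def add (x y : ℝ) : Timed ℝ := ⟨x + y, 1⟩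

def sub (x y : ℝ) : Timed ℝ := ⟨x - y, 1⟩

def mul (x y : ℝ) : Timed ℝ := ⟨x * y, 1⟩

def div (x y : ℝ) : Timed ℝ := ⟨x / y, 1⟩

def sqrt (x : ℝ) : Timed ℝ := ⟨Real.sqrt x, 1⟩

def log (x : ℝ) : Timed ℝ := ⟨Real.log x, 1⟩

def pow (x y : ℝ) : Timed ℝ := ⟨x ^ y, 1⟩

/-- Round up to a natural number. -/
def ceil (x : ℝ) : Timed ℕ := ⟨⌈x⌉₊, 1⟩

/-- Convert a natural number to a real. -/
def toReal (n : ℕ) : Timed ℝ := ⟨(n : ℝ), 1⟩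

def le (x y : ℝ) : Timed Bool := ⟨decide (x ≤ y), 1⟩

def lt (x y : ℝ) : Timed Bool := ⟨decide (x < y), 1⟩

/-- Read a cell of an array. -/
def read {k : ℕ} {α : Type} (v : Fin k → α) (j : Fin k) : Timed α := ⟨v j, 1⟩

/-- Draw the `j`-th coordinate of the `i`-th random vector; `ω` is the source of randomness. -/
def draw (ω : ℕ × ℕ → ℝ) (i j : ℕ) : Timed ℝ := ⟨ω (i, j), 1⟩

/-- Append an entry to a list. -/
def push {α : Type} (l : List α) (a : α) : Timed (List α) := ⟨a :: l, 1⟩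

/-- One step of control flow. -/
def step : Timed Unit := ⟨(), 1⟩

/-- Fill a new array of length `k`: cell `i` is computed by `f i` and then written (one step). -/
def fill {k : ℕ} {α : Type} (f : Fin k → Timed α) : Timed (Fin k → α) :=
  ⟨fun i => (f i).val, ∑ i, ((f i).steps + 1)⟩

/-- A loop over a list with a state; each iteration costs one step besides its body. -/
def loop {ι σ : Type} (body : σ → ι → Timed σ) : List ι → σ → Timed σ
  | [], s => pure s
  | i :: l, s => ⟨(loop body l (body s i).val).val,
      1 + (body s i).steps + (loop body l (body s i).val).steps⟩

/-- A hash table with `m` empty buckets; creating it costs one step per bucket. -/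
def newTable (m n : ℕ) : Timed (Fin m → List (Fin n)) := ⟨fun _ => [], m⟩

/-- Insert the entry `k` into bucket `i` of a hash table. -/
def insert {m n : ℕ} (H : Fin m → List (Fin n)) (i : Fin m) (k : Fin n) :
    Timed (Fin m → List (Fin n)) :=
  ⟨Function.update H i (k :: H i), 1⟩

/-- The inner product of two vectors, coordinate by coordinate. -/
def dot {d : ℕ} (u v : Fin d → ℝ) : Timed ℝ :=
  loop (fun acc j => do
    let a ← read u j
    let b ← read v j
    let p ← mul a b
    add acc p) (List.finRange d) 0

end

end RealRAM

/-! ## The Top-1 data structure -/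

namespace Top1

open RealRAM

noncomputable section

/-- The unit sphere of `ℝ ^ d`. -/
abbrev UnitSphere (d : ℕ) : Type := Metric.sphere (0 : EuclideanSpace ℝ (Fin d)) 1

/-- Inner product similarity of two points of the sphere. -/
def sim {d : ℕ} (x y : UnitSphere d) : ℝ :=
  inner ℝ (x : EuclideanSpace ℝ (Fin d)) (y : EuclideanSpace ℝ (Fin d))

/-- The array of coordinates of a point of the sphere. -/
def coords {d : ℕ} (x : UnitSphere d) : Fin d → ℝ := fun j => x.1 j

/-- The number `m = ⌈n ^ ((1 - β²) / (1 - αβ)²)⌉` of Gaussian filters. -/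
def numFilters (α β : ℝ) (n : ℕ) : ℕ :=
  ⌈(n : ℝ) ^ ((1 - β ^ 2) / (1 - α * β) ^ 2)⌉₊

/-- The exponent `ρ = (1 - α²)(1 - β²) / (1 - αβ)²`. -/
def rho (α β : ℝ) : ℝ := (1 - α ^ 2) * (1 - β ^ 2) / (1 - α * β) ^ 2

/-- The data structure: `m` filters, a hash table with `m` buckets that hold (the indices of) the
stored points, the coordinates of the stored points, and the query threshold. -/
structure DataStructure (n d : ℕ) where
  m : ℕ
  filter : Fin m → Fin d → ℝ
  bucket : Fin m → List (Fin n)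
  point : Fin n → Fin d → ℝ
  threshold : ℝ

/-- Space in words: `m` filters of `d` words, `n` points of `d` words, for each bucket a header and
two words (the entry and a link) per entry, and the two numbers `m` and `threshold`. -/
def DataStructure.space {n d : ℕ} (D : DataStructure n d) : ℕ :=
  D.m * d + n * d + (∑ i, (1 + 2 * (D.bucket i).length)) + 2

/-- Compute `m`. -/
def computeNumFilters (α β : ℝ) (n : ℕ) : Timed ℕ := do
  let bb ← mul β β
  let p ← sub 1 bb
  let ab ← mul α β
  let r ← sub 1 ab
  let rr ← mul r r
  let e ← div p rr
  let N ← toReal n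
  let y ← pow N e
  ceil y

/-- Compute `η = α √(2 log m) - √(2 (1 - α²) log log m)`. -/
def computeThreshold (α : ℝ) (m : ℕ) : Timed ℝ := do
  let M ← toReal m
  let L ← log M
  let LL ← log L
  let t ← mul 2 L
  let s ← sqrt t
  let u ← mul α s
  let aa ← mul α α
  let c ← sub 1 aa
  let c2 ← mul 2 c
  let w ← mul c2 LL
  let v ← sqrt w
  sub u v

/-- An index `i` maximizing the inner product of `A i` with `x` (the first one if there are several,
`none` if there is no filter at all). -/
def argmax {m d : ℕ} (A : Fin m → Fin d → ℝ) (x : Fin d → ℝ) : Timed (Option (Fin m)) := do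
  let best ← loop (fun (b : Option (Fin m × ℝ)) i => do
    let a ← read A i
    let v ← dot a x
    match b with
    | none => pure (some (i, v))
    | some (j, w) => do
      let c ← lt w v
      if c then pure (some (i, v)) else pure (some (j, w))) (List.finRange m) none
  pure (best.map Prod.fst)

/-- The construction procedure on the dataset `S` and the source of randomness `ω`. -/
def construct {n d : ℕ} (α β : ℝ) (S : Fin n → Fin d → ℝ) (ω : ℕ × ℕ → ℝ) :
    Timed (DataStructure n d) := do
  let m ← computeNumFilters α β n
  let A ← fill (fun i : Fin m => fill (fun j : Fin d => draw ω i j))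
  let P ← fill (fun k : Fin n => fill (fun j : Fin d => read (S k) j))
  let H₀ ← newTable m n
  let H ← loop (fun H k => do
    let x ← read P k
    let best ← argmax A x
    match best with
    | none => pure H
    | some i => insert H i k) (List.finRange n) H₀
  let η ← computeThreshold α m
  pure ⟨m, A, H, P, η⟩

/-- The search procedure: the list of the buckets `i` with `⟨a_i, q⟩ ≥ η`. -/
def search {n d : ℕ} (D : DataStructure n d) (q : Fin d → ℝ) : Timed (List (Fin D.m)) :=
  loop (fun B i => do
    let a ← read D.filter i
    let v ← dot a q
    let c ← le D.threshold v
    if c then push B i else pure B) (List.finRange D.m) []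

/-- Go through the entries of one bucket until one with similarity at least `β` is met. -/
def scanBucket {n d : ℕ} (D : DataStructure n d) (β : ℝ) (q : Fin d → ℝ) :
    List (Fin n) → Timed (Option (Fin n))
  | [] => pure none
  | k :: l => do
    step
    let x ← read D.point k
    let v ← dot q x
    let c ← le β v
    if c then pure (some k) else scanBucket D β q l

/-- Go through the given buckets until a point with similarity at least `β` is met. -/
def scanBuckets {n d : ℕ} (D : DataStructure n d) (β : ℝ) (q : Fin d → ℝ) :
    List (Fin D.m) → Timed (Option (Fin n))
  | [] => pure none
  | i :: l => do
    step
    let b ← read D.bucket i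
    let r ← scanBucket D β q b
    match r with
    | some k => pure (some k)
    | none => scanBuckets D β q l

/-- The query procedure; it returns (the index of) a stored point, or `none`. -/
def query {n d : ℕ} (D : DataStructure n d) (β : ℝ) (q : Fin d → ℝ) :
    Timed (Option (Fin n)) := do
  let B ← search D q
  scanBuckets D β q B

/-- The law of the source of randomness: independent standard normal variables. -/
def gaussianSource : Measure (ℕ × ℕ → ℝ) :=
  Measure.infinitePi (fun _ : ℕ × ℕ => gaussianReal 0 1)

/-! ### The quantities in the analysis -/

/-- The construction run on a dataset in the sphere. -/
def build {n d : ℕ} (α β : ℝ) (S : Fin n → UnitSphere d) (ω : ℕ × ℕ → ℝ) :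
    Timed (DataStructure n d) :=
  construct α β (fun k => coords (S k)) ω

/-- The query `q` returns a point of the dataset with similarity at least `β` to `q`. -/
def Succeeds {n d : ℕ} (α β : ℝ) (S : Fin n → UnitSphere d) (q : UnitSphere d)
    (ω : ℕ × ℕ → ℝ) : Prop :=
  ∃ k, (query (build α β S ω).val β (coords q)).val = some k ∧ β ≤ sim q (S k)

/-- The number of buckets that the query `q` inspects. -/
def numInspected {n d : ℕ} (α β : ℝ) (S : Fin n → UnitSphere d) (q : UnitSphere d)
    (ω : ℕ × ℕ → ℝ) : ℕ :=
  (search (build α β S ω).val (coords q)).val.length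

/-- The `k`-th point is in one of the buckets that the query `q` inspects. -/
def Inspected {n d : ℕ} (α β : ℝ) (S : Fin n → UnitSphere d) (q : UnitSphere d)
    (ω : ℕ × ℕ → ℝ) (k : Fin n) : Prop :=
  ∃ i ∈ (search (build α β S ω).val (coords q)).val, k ∈ (build α β S ω).val.bucket i

/-- The number of far points (similarity to `q` less than `β`) in the inspected buckets. -/
def numFar {n d : ℕ} (α β : ℝ) (S : Fin n → UnitSphere d) (q : UnitSphere d)
    (ω : ℕ × ℕ → ℝ) : ℕ :=
  {k : Fin n | sim q (S k) < β ∧ Inspected α β S q ω k}.ncard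

end

end Top1

/-! Fix a stored point x with similarity s to q, and let X_i and Y_i be the scores of x and q in
filter i. Projecting q orthogonally on x gives Y_i = s X_i + W_i, where the Gaussian family W has
variance 1 - s² and is independent of X. The bucket I of x is a function of X alone, so W_I behaves
like a single W_i and no factor m is lost to a union bound (`measure_exists_isFirstMax_le`).

Close points: X_I is almost √(2 log m) with high probability, so Y_I falls below η only if W_I is
below -√((1 - α²) log log m). The second term of η is the margin that makes this unlikely
(`measure_not_inspected_le_exp`).

Far points, s ≥ 0: if x is inspected, either X_I < √(2 log m) and W_I makes up the gap to η, or some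
filter has both X_i ≥ √(2 log m) and Y_i ≥ η. Both events cost about m^(-(α-s)²/(1-s²)), which is
largest at s = β; a negative s is no worse than s = 0, up to the exponentially rare event that all
X_i are negative (`measure_inspected_le_exp`). For the given m this cost is n^(-(1-ρ)) by
`one_sub_rho`, and summing over n points leaves n^ρ. The expected number of inspected buckets is at
most m exp(-η²/2), about m^(1-α²), which is again n^ρ.

The error in these exponents is `crossTerm`, which comes from the mixed term of a square. It equals
2 (1-α²) log m times the root of log log m / ((1-α²) log m). The first factor is O(log n) and the
second tends to 0 by the assumption on 1 - α² (`tendsto_crossTerm_div_log`). Time and space are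
worst-case counts, using m ≥ n. -/

namespace Timed

/-! ### Values and step counts of the RAM primitives -/

@[simp] theorem val_pure {α : Type} (a : α) : (pure a : Timed α).val = a := rfl

@[simp] theorem steps_pure {α : Type} (a : α) : (pure a : Timed α).steps = 0 := rfl

@[simp] theorem val_bind {α β : Type} (x : Timed α) (f : α → Timed β) :
    (x >>= f).val = (f x.val).val := rfl

@[simp] theorem steps_bind {α β : Type} (x : Timed α) (f : α → Timed β) :
    (x >>= f).steps = x.steps + (f x.val).steps := rfl

end Timed

namespace RealRAM

theorem loop_val {ι σ : Type} (body : σ → ι → Timed σ) (l : List ι) (s : σ) :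
    (loop body l s).val = l.foldl (fun s i => (body s i).val) s := by
  induction l generalizing s with
  | nil => rfl
  | cons i l ih => exact ih _

theorem loop_steps_le {ι σ : Type} (body : σ → ι → Timed σ) (K : ℕ)
    (h : ∀ s i, (body s i).steps ≤ K) (l : List ι) (s : σ) :
    (loop body l s).steps ≤ l.length * (1 + K) := by
  induction l generalizing s with
  | nil => simp [loop]
  | cons i l ih =>
    have h1 := h s i
    have h2 := ih (body s i).val
    simp only [loop, List.length_cons]
    linarith

theorem fill_steps_le {k : ℕ} {α : Type} (f : Fin k → Timed α) (K : ℕ)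
    (h : ∀ i, (f i).steps ≤ K) : (fill f).steps ≤ k * (K + 1) := by
  calc (fill f).steps = ∑ i, ((f i).steps + 1) := rfl
    _ ≤ ∑ _i : Fin k, (K + 1) := Finset.sum_le_sum fun i _ => Nat.succ_le_succ (h i)
    _ = k * (K + 1) := by simp

theorem foldl_add_eq_sum_map {ι : Type} (f : ι → ℝ) (l : List ι) (a : ℝ) :
    l.foldl (fun acc j => acc + f j) a = a + (l.map f).sum := by
  induction l generalizing a with
  | nil => simp
  | cons i l ih => simp [ih, add_assoc]

theorem dot_val {d : ℕ} (u v : Fin d → ℝ) : (dot u v).val = ∑ j, u j * v j := by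
  have : (dot u v).val = (List.finRange d).foldl (fun acc j => acc + u j * v j) 0 :=
    loop_val _ _ _
  rw [this, foldl_add_eq_sum_map, zero_add, Fin.sum_univ_def]

theorem dot_steps_le {d : ℕ} (u v : Fin d → ℝ) : (dot u v).steps ≤ 5 * d := by
  refine (loop_steps_le _ 4 (fun s i => ?_) _ _).trans ?_
  · simp [RealRAM.read, mul, add]
  · simp [mul_comm]

end RealRAM

/-! ### Correctness and worst-case cost of the Top-1 procedures -/

namespace Top1

open RealRAM

/-- `i` is the first index at which `X` attains its maximum. -/
def IsFirstMax {m : ℕ} (X : Fin m → ℝ) (i : Fin m) : Prop :=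
  (∀ j, X j ≤ X i) ∧ ∀ j < i, X j < X i

/-- Ties are broken by index, so the events that a given index wins are disjoint outright, and ties
need not be shown to have probability zero. -/
theorem IsFirstMax.unique {m : ℕ} {X : Fin m → ℝ} {i j : Fin m} (hi : IsFirstMax X i)
    (hj : IsFirstMax X j) : i = j := by
  rcases lt_trichotomy i j with h | h | h
  · exact absurd (hj.2 i h) (not_lt.2 (hi.1 j))
  · exact h
  · exact absurd (hi.2 j h) (not_lt.2 (hj.1 i))

/-- The update of the running maximum in the search for a maximizer of `X`. -/
noncomputable def updateBest {m : ℕ} (X : Fin m → ℝ) (b : Option (Fin m × ℝ)) (i : Fin m) :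
    Option (Fin m × ℝ) :=
  match b with
  | none => some (i, X i)
  | some (j, w) => if w < X i then some (i, X i) else some (j, w)

/-- The loop invariant of the running maximum. Since the list is increasing, a new index exceeds all
earlier ones, so replacing only on strict improvement keeps the first maximizer. -/
theorem foldl_updateBest {m : ℕ} (X : Fin m → ℝ) (l : List (Fin m)) (hl : l.Pairwise (· < ·)) :
    (l = [] ∧ l.foldl (updateBest X) none = none) ∨
      ∃ i ∈ l, l.foldl (updateBest X) none = some (i, X i) ∧
        ∀ j ∈ l, X j ≤ X i ∧ (j < i → X j < X i) := by
  induction l using List.reverseRecOn with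
  | nil => exact Or.inl ⟨rfl, rfl⟩
  | append_singleton l a ih =>
    right
    obtain ⟨hl1, -, hla⟩ := List.pairwise_append.1 hl
    rw [List.foldl_append]
    rcases ih hl1 with ⟨rfl, h⟩ | ⟨i, hi, h, hmax⟩
    · exact ⟨a, by simp, by simp [updateBest], by simp⟩
    · rw [h]
      by_cases hlt : X i < X a
      · refine ⟨a, by simp, by simp [updateBest, hlt], fun j hj => ?_⟩
        rcases List.mem_append.1 hj with hj | hj
        · have := (hmax j hj).1.trans_lt hlt
          exact ⟨this.le, fun _ => this⟩
        · rw [List.mem_singleton.1 hj]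
          exact ⟨le_rfl, fun h => absurd h (lt_irrefl _)⟩
      · refine ⟨i, by simp [hi], by simp [updateBest, hlt], fun j hj => ?_⟩
        rcases List.mem_append.1 hj with hj | hj
        · exact hmax j hj
        · rw [List.mem_singleton.1 hj]
          exact ⟨not_lt.1 hlt, fun h => absurd (hla i hi a (by simp)) (not_lt.2 h.le)⟩

theorem argmax_val {m d : ℕ} (A : Fin m → Fin d → ℝ) (x : Fin d → ℝ) :
    (argmax A x).val =
      ((List.finRange m).foldl (updateBest fun i => ∑ j, A i j * x j) none).map Prod.fst := by
  unfold argmax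
  simp only [Timed.val_bind, Timed.val_pure, loop_val]
  congr 2
  funext b i
  rcases b with _ | ⟨j, w⟩
  · simp [updateBest, RealRAM.read, dot_val]
  · simp only [updateBest, RealRAM.read, dot_val, lt, Timed.val_bind, decide_eq_true_eq]
    split_ifs <;> rfl

theorem argmax_eq_some_iff {m d : ℕ} (A : Fin m → Fin d → ℝ) (x : Fin d → ℝ) (i : Fin m) :
    (argmax A x).val = some i ↔ IsFirstMax (fun i => ∑ j, A i j * x j) i := by
  rw [argmax_val]
  rcases foldl_updateBest (fun i => ∑ j, A i j * x j) (List.finRange m)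
    (List.pairwise_lt_finRange m) with ⟨hm, -⟩ | ⟨k, -, h, hmax⟩
  · have := List.mem_finRange i
    simp [hm] at this
  · have hk : IsFirstMax (fun i => ∑ j, A i j * x j) k :=
      ⟨fun j => (hmax j (List.mem_finRange j)).1, fun j => (hmax j (List.mem_finRange j)).2⟩
    rw [h]
    simp only [Option.map_some, Option.some.injEq]
    exact ⟨fun h => h ▸ hk, fun h => hk.unique h⟩

theorem exists_isFirstMax {m : ℕ} (hm : 0 < m) (X : Fin m → ℝ) : ∃ i, IsFirstMax X i := by
  rcases foldl_updateBest X (List.finRange m) (List.pairwise_lt_finRange m) with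
    ⟨h, -⟩ | ⟨k, -, -, hmax⟩
  · simp [List.finRange_eq_nil_iff] at h
    omega
  · exact ⟨k, fun j => (hmax j (List.mem_finRange j)).1, fun j => (hmax j (List.mem_finRange j)).2⟩

theorem argmax_steps_le {m d : ℕ} (A : Fin m → Fin d → ℝ) (x : Fin d → ℝ) :
    (argmax A x).steps ≤ m * (5 * d + 3) := by
  unfold argmax
  simp only [Timed.steps_bind, Timed.steps_pure, add_zero]
  refine (loop_steps_le _ (5 * d + 2) (fun s i => ?_) _ _).trans ?_
  · have h := dot_steps_le (A i) x
    rcases s with _ | ⟨j, w⟩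
    · simp [RealRAM.read]; omega
    · simp only [Timed.steps_bind, RealRAM.read, lt, decide_eq_true_eq]
      split_ifs <;> simp <;> omega
  · simp only [List.length_finRange]
    exact Nat.mul_le_mul_left _ (by omega)

/-- Inserting the entry `k` into the bucket prescribed by `g k`. -/
def insertBucket {m n : ℕ} (g : Fin n → Option (Fin m)) (H : Fin m → List (Fin n)) (k : Fin n) :
    Fin m → List (Fin n) :=
  match g k with
  | none => H
  | some i => Function.update H i (k :: H i)

theorem mem_foldl_insertBucket {m n : ℕ} (g : Fin n → Option (Fin m)) (l : List (Fin n))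
    (H : Fin m → List (Fin n)) (k : Fin n) (i : Fin m) :
    k ∈ l.foldl (insertBucket g) H i ↔ k ∈ H i ∨ (k ∈ l ∧ g k = some i) := by
  induction l generalizing H with
  | nil => simp
  | cons a l ih =>
    rw [List.foldl_cons, ih]
    have : k ∈ insertBucket g H a i ↔ k ∈ H i ∨ (k = a ∧ g k = some i) := by
      unfold insertBucket
      rcases hg : g a with _ | j
      · simp only
        constructor
        · exact Or.inl
        · rintro (h | ⟨rfl, h⟩)
          · exact h
          · simp [hg] at h
      · by_cases hij : i = j
        · subst hij
          simp only [Function.update_self, List.mem_cons]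
          constructor
          · rintro (rfl | h)
            · exact Or.inr ⟨rfl, hg⟩
            · exact Or.inl h
          · rintro (h | ⟨rfl, -⟩)
            · exact Or.inr h
            · exact Or.inl rfl
        · simp only [Function.update_of_ne hij]
          constructor
          · exact Or.inl
          · rintro (h | ⟨rfl, h⟩)
            · exact h
            · rw [hg] at h
              exact absurd (Option.some.inj h).symm hij
    rw [this, List.mem_cons]
    tauto

theorem sum_length_foldl_insertBucket_le {m n : ℕ} (g : Fin n → Option (Fin m)) (l : List (Fin n))
    (H : Fin m → List (Fin n)) :
    ∑ i, (l.foldl (insertBucket g) H i).length ≤ (∑ i, (H i).length) + l.length := by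
  induction l generalizing H with
  | nil => simp
  | cons a l ih =>
    rw [List.foldl_cons]
    refine (ih _).trans ?_
    have : ∑ i, (insertBucket g H a i).length ≤ (∑ i, (H i).length) + 1 := by
      unfold insertBucket
      rcases g a with _ | j
      · simp
      · have : ∀ i, (Function.update H j (a :: H j) i).length =
            (H i).length + if i = j then 1 else 0 := by
          intro i
          by_cases h : i = j
          · subst h; simp
          · simp [h]
        simp [this, Finset.sum_add_distrib]
    rw [List.length_cons]
    omega

/-- The query threshold `η = α √(2 log m) - √(2 (1 - α²) log log m)`. -/
noncomputable def eta (α : ℝ) (m : ℕ) : ℝ :=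
  α * √(2 * Real.log m) - √(2 * (1 - α ^ 2) * Real.log (Real.log m))

theorem computeNumFilters_val (α β : ℝ) (n : ℕ) :
    (computeNumFilters α β n).val = numFilters α β n := by
  simp [computeNumFilters, numFilters, mul, sub, div, toReal, RealRAM.pow, RealRAM.ceil, sq]

theorem computeThreshold_val (α : ℝ) (m : ℕ) : (computeThreshold α m).val = eta α m := by
  simp [computeThreshold, eta, mul, sub, toReal, RealRAM.log, RealRAM.sqrt, sq]

section Build

variable {n d : ℕ} (α β : ℝ) (S : Fin n → UnitSphere d) (ω : ℕ × ℕ → ℝ)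

/-- The inner product of the `i`-th filter with `v`. -/
noncomputable def score {d : ℕ} (v : Fin d → ℝ) (i : ℕ) (ω : ℕ × ℕ → ℝ) : ℝ :=
  ∑ j : Fin d, ω (i, j) * v j

theorem build_m : (build α β S ω).val.m = (computeNumFilters α β n).val := rfl

theorem build_filter : (build α β S ω).val.filter = fun i j => ω (i.val, j.val) := rfl

theorem build_point : (build α β S ω).val.point = fun k => coords (S k) := rfl

theorem build_threshold : (build α β S ω).val.threshold = eta α (build α β S ω).val.m :=
  computeThreshold_val _ _

theorem build_bucket : (build α β S ω).val.bucket =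
    (List.finRange n).foldl
      (insertBucket fun k => (argmax (build α β S ω).val.filter (coords (S k))).val)
      (fun _ => []) := by
  refine (loop_val _ _ _).trans ?_
  congr 1
  funext H k
  simp only [insertBucket, Timed.val_bind, RealRAM.read]
  split <;> rename_i h
  · rw [show (argmax (build α β S ω).val.filter (coords (S k))).val = none from h]
    rfl
  · rw [show (argmax (build α β S ω).val.filter (coords (S k))).val = some _ from h]
    rfl

theorem mem_bucket_iff (i : Fin (build α β S ω).val.m) (k : Fin n) :
    k ∈ (build α β S ω).val.bucket i ↔
      IsFirstMax (fun i : Fin (build α β S ω).val.m => score (coords (S k)) i ω) i := by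
  rw [build_bucket, mem_foldl_insertBucket, argmax_eq_some_iff]
  simp [build_filter, score]

theorem sum_length_bucket_le : ∑ i, ((build α β S ω).val.bucket i).length ≤ n := by
  rw [build_bucket]
  exact (sum_length_foldl_insertBucket_le _ _ _).trans (by simp)

end Build

theorem foldl_ite_push {ι : Type} (p : ι → Prop) [DecidablePred p] (l B : List ι) :
    l.foldl (fun B i => if p i then i :: B else B) B = (l.filter p).reverse ++ B := by
  induction l generalizing B with
  | nil => simp
  | cons i l ih =>
    rw [List.foldl_cons, ih]
    by_cases h : p i <;> simp [h]

open Classical in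
theorem search_val {n d : ℕ} (D : DataStructure n d) (q : Fin d → ℝ) :
    (search D q).val =
      ((List.finRange D.m).filter fun i => D.threshold ≤ ∑ j, D.filter i j * q j).reverse := by
  unfold search
  rw [loop_val]
  trans (List.finRange D.m).foldl
    (fun B i => if D.threshold ≤ ∑ j, D.filter i j * q j then i :: B else B) []
  · congr 1
    funext B i
    simp only [Timed.val_bind, RealRAM.read, dot_val, le, decide_eq_true_eq]
    split_ifs <;> rfl
  · rw [foldl_ite_push, List.append_nil]

theorem search_steps_le {n d : ℕ} (D : DataStructure n d) (q : Fin d → ℝ) :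
    (search D q).steps ≤ D.m * (5 * d + 4) := by
  unfold search
  refine (loop_steps_le _ (5 * d + 3) (fun s i => ?_) _ _).trans ?_
  · have h := dot_steps_le (D.filter i) q
    simp only [Timed.steps_bind, RealRAM.read, le, decide_eq_true_eq]
    split_ifs <;> simp [push] <;> omega
  · simp only [List.length_finRange]
    exact Nat.mul_le_mul_left _ (by omega)

theorem scanBucket_steps_le {n d : ℕ} (D : DataStructure n d) (β : ℝ) (q : Fin d → ℝ)
    (l : List (Fin n)) : (scanBucket D β q l).steps ≤ l.length * (5 * d + 3) := by
  induction l with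
  | nil => simp [scanBucket]
  | cons k l ih =>
    have h := dot_steps_le q (D.point k)
    simp only [scanBucket, Timed.steps_bind, step, RealRAM.read, le, decide_eq_true_eq,
      List.length_cons]
    split_ifs
    · simp
      nlinarith
    · linarith

theorem scanBuckets_steps_le {n d : ℕ} (D : DataStructure n d) (β : ℝ) (q : Fin d → ℝ)
    (l : List (Fin D.m)) :
    (scanBuckets D β q l).steps ≤
      l.length * 2 + (l.map fun i => (D.bucket i).length).sum * (5 * d + 3) := by
  induction l with
  | nil => simp [scanBuckets]
  | cons i l ih =>
    have h := scanBucket_steps_le D β q (D.bucket i)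
    simp only [scanBuckets, Timed.steps_bind, step, RealRAM.read, List.length_cons, List.map_cons,
      List.sum_cons]
    rcases (scanBucket D β q (D.bucket i)).val with _ | k
    · simp only
      linarith
    · simp only [Timed.steps_pure]
      nlinarith [Nat.zero_le ((l.map fun i => (D.bucket i).length).sum * (5 * d + 3))]

/-- Every bucket is charged as if it were inspected in full, so the bound involves no randomness. -/
theorem query_steps_le {n d : ℕ} (D : DataStructure n d) (β : ℝ) (q : Fin d → ℝ) :
    (query D β q).steps ≤
      D.m * (5 * d + 6) + (∑ i, (D.bucket i).length) * (5 * d + 3) := by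
  classical
  have h1 := search_steps_le D q
  have h2 := scanBuckets_steps_le D β q (search D q).val
  have h3 : (search D q).val.length ≤ D.m := by
    rw [search_val, List.length_reverse]
    exact (List.length_filter_le _ _).trans (by simp)
  have h4 : ((search D q).val.map fun i => (D.bucket i).length).sum ≤
      ∑ i, (D.bucket i).length := by
    rw [search_val, List.map_reverse, List.sum_reverse, Fin.sum_univ_def]
    exact List.Sublist.sum_le_sum (List.filter_sublist.map _) (by simp)
  have h5 := Nat.mul_le_mul_right (5 * d + 3) h4
  change (search D q).steps + (scanBuckets D β q (search D q).val).steps ≤ _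
  linarith

theorem scanBucket_val_isSome {n d : ℕ} (D : DataStructure n d) (β : ℝ) (q : Fin d → ℝ)
    (l : List (Fin n)) (h : ∃ k ∈ l, β ≤ ∑ j, q j * D.point k j) :
    (scanBucket D β q l).val ≠ none := by
  induction l with
  | nil => simp at h
  | cons k l ih =>
    simp only [scanBucket, Timed.val_bind, RealRAM.read, le, dot_val, decide_eq_true_eq]
    split_ifs with hk
    · simp
    · refine ih ?_
      obtain ⟨k', hk', h⟩ := h
      rcases List.mem_cons.1 hk' with rfl | hk'
      · exact absurd h hk
      · exact ⟨k', hk', h⟩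

theorem scanBucket_val_sound {n d : ℕ} (D : DataStructure n d) (β : ℝ) (q : Fin d → ℝ)
    (l : List (Fin n)) (k : Fin n) (h : (scanBucket D β q l).val = some k) :
    β ≤ ∑ j, q j * D.point k j := by
  induction l with
  | nil => simp [scanBucket] at h
  | cons a l ih =>
    simp only [scanBucket, Timed.val_bind, RealRAM.read, le, dot_val, decide_eq_true_eq] at h
    split_ifs at h with hk
    · simp only [Timed.val_pure, Option.some.injEq] at h
      exact h ▸ hk
    · exact ih h

theorem scanBuckets_val_isSome {n d : ℕ} (D : DataStructure n d) (β : ℝ) (q : Fin d → ℝ)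
    (l : List (Fin D.m)) (h : ∃ i ∈ l, ∃ k ∈ D.bucket i, β ≤ ∑ j, q j * D.point k j) :
    (scanBuckets D β q l).val ≠ none := by
  induction l with
  | nil => simp at h
  | cons a l ih =>
    simp only [scanBuckets, Timed.val_bind, RealRAM.read]
    rcases hs : (scanBucket D β q (D.bucket a)).val with _ | k
    · refine ih ?_
      obtain ⟨i, hi, h⟩ := h
      rcases List.mem_cons.1 hi with rfl | hi
      · exact absurd hs (scanBucket_val_isSome D β q _ h)
      · exact ⟨i, hi, h⟩
    · simp

theorem scanBuckets_val_sound {n d : ℕ} (D : DataStructure n d) (β : ℝ) (q : Fin d → ℝ)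
    (l : List (Fin D.m)) (k : Fin n) (h : (scanBuckets D β q l).val = some k) :
    β ≤ ∑ j, q j * D.point k j := by
  induction l with
  | nil => simp [scanBuckets] at h
  | cons a l ih =>
    simp only [scanBuckets, Timed.val_bind, RealRAM.read] at h
    rcases hs : (scanBucket D β q (D.bucket a)).val with _ | k'
    · rw [hs] at h
      exact ih h
    · rw [hs] at h
      simp only [Timed.val_pure, Option.some.injEq] at h
      exact scanBucket_val_sound D β q _ k (h ▸ hs)

theorem sim_eq_sum {d : ℕ} (x y : UnitSphere d) : sim x y = ∑ j, coords x j * coords y j := by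
  simp [sim, coords, PiLp.inner_apply, mul_comm]

/-- The scan may stop at a point other than `k`. The inspected point only rules out the answer
`none`; soundness of the scan then covers whatever index is returned. -/
theorem Inspected.succeeds {n d : ℕ} {α β : ℝ} {S : Fin n → UnitSphere d} {q : UnitSphere d}
    {ω : ℕ × ℕ → ℝ} {k : Fin n} (h : Inspected α β S q ω k) (hk : β ≤ sim q (S k)) :
    Succeeds α β S q ω := by
  obtain ⟨i, hi, hik⟩ := h
  have h1 := scanBuckets_val_isSome (build α β S ω).val β (coords q) _
    ⟨i, hi, k, hik, by simpa [build_point, ← sim_eq_sum] using hk⟩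
  obtain ⟨k', hk'⟩ := Option.ne_none_iff_exists'.1 h1
  refine ⟨k', hk', ?_⟩
  have := scanBuckets_val_sound _ _ _ _ _ hk'
  simpa [build_point, ← sim_eq_sum] using this

theorem inspected_iff {n d : ℕ} (α β : ℝ) (S : Fin n → UnitSphere d) (q : UnitSphere d)
    (ω : ℕ × ℕ → ℝ) (k : Fin n) :
    Inspected α β S q ω k ↔ ∃ i : Fin (numFilters α β n),
      IsFirstMax (fun i : Fin (numFilters α β n) => score (coords (S k)) i ω) i ∧
        eta α (numFilters α β n) ≤ score (coords q) i ω := by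
  classical
  rw [← computeNumFilters_val, ← build_m α β S ω]
  refine exists_congr fun i => ?_
  rw [mem_bucket_iff, search_val, and_comm]
  simp [build_threshold, build_filter, score]

open Classical in
theorem numInspected_eq {n d : ℕ} (α β : ℝ) (S : Fin n → UnitSphere d) (q : UnitSphere d)
    (ω : ℕ × ℕ → ℝ) :
    numInspected α β S q ω = ∑ i : Fin (numFilters α β n),
      if eta α (numFilters α β n) ≤ score (coords q) i ω then 1 else 0 := by
  rw [← computeNumFilters_val, ← build_m α β S ω, numInspected, search_val, List.length_reverse,
    Finset.sum_boole, ← Finset.length_toList]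
  simp only [Nat.cast_id, Finset.length_toList]
  rw [← List.toFinset_card_of_nodup ((List.nodup_finRange _).filter _)]
  congr 1
  ext i
  rw [List.mem_toFinset, Finset.mem_filter]
  simp [build_threshold, build_filter, score]

theorem build_steps_le {n d : ℕ} (α β : ℝ) (S : Fin n → UnitSphere d) (ω : ℕ × ℕ → ℝ) :
    (build α β S ω).steps ≤ 9 + numFilters α β n * (2 * d + 1) + n * (2 * d + 1) +
      numFilters α β n + n * (numFilters α β n * (5 * d + 3) + 3) + 13 := by
  unfold build construct
  simp only [Timed.steps_bind, Timed.steps_pure, newTable]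
  rw [computeNumFilters_val]
  have h1 : (computeNumFilters α β n).steps ≤ 9 := by
    simp [computeNumFilters, mul, sub, div, toReal, RealRAM.pow, RealRAM.ceil]
  have h2 : (computeThreshold α (numFilters α β n)).steps ≤ 13 := by
    simp [computeThreshold, mul, sub, toReal, RealRAM.log, RealRAM.sqrt]
  have h3 : (fill fun i : Fin (numFilters α β n) => fill fun j : Fin d => draw ω i j).steps ≤
      numFilters α β n * (2 * d + 1) :=
    fill_steps_le _ _ fun i => (fill_steps_le _ 1 fun j => by simp [draw]).trans (by omega)
  have h4 : (fill fun k : Fin n => fill fun j : Fin d => RealRAM.read (coords (S k)) j).steps ≤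
      n * (2 * d + 1) :=
    fill_steps_le _ _ fun i => (fill_steps_le _ 1 fun j => by simp [RealRAM.read]).trans (by omega)
  refine (Nat.add_le_add h1 (Nat.add_le_add h3 (Nat.add_le_add h4 (Nat.add_le_add le_rfl
    (Nat.add_le_add (loop_steps_le _ (numFilters α β n * (5 * d + 3) + 2) (fun H k => ?_) _ _)
      (Nat.add_le_add h2 le_rfl)))))).trans ?_
  · simp only [Timed.steps_bind]
    have := argmax_steps_le
      (fill fun i : Fin (numFilters α β n) => fill fun j : Fin d => draw ω i j).val
      (RealRAM.read (fill fun k : Fin n => fill fun j : Fin d =>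
        RealRAM.read (coords (S k)) j).val k).val
    split
    · simp [RealRAM.read] at this ⊢; omega
    · simp [RealRAM.read, RealRAM.insert] at this ⊢; omega
  · rw [List.length_finRange, show 1 + (numFilters α β n * (5 * d + 3) + 2) =
      numFilters α β n * (5 * d + 3) + 3 by omega]
    linarith

end Top1

/-! ### Gaussian scores: covariances, independence and tails -/

namespace Top1

instance : IsProbabilityMeasure gaussianSource := by
  unfold gaussianSource; infer_instance

theorem map_eval_gaussianSource (p : ℕ × ℕ) :
    gaussianSource.map (fun ω => ω p) = gaussianReal 0 1 :=
  Measure.infinitePi_map_eval _ p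

theorem hasGaussianLaw_eval (p : ℕ × ℕ) : HasGaussianLaw (fun ω => ω p) gaussianSource := by
  have : IsGaussian (gaussianSource.map fun ω => ω p) := by
    rw [map_eval_gaussianSource]; infer_instance
  exact IsGaussian.hasGaussianLaw

theorem iIndepFun_eval : iIndepFun (fun (p : ℕ × ℕ) (ω : ℕ × ℕ → ℝ) => ω p) gaussianSource :=
  iIndepFun_infinitePi (X := fun _ x => x) fun _ => measurable_id

theorem integral_eval (p : ℕ × ℕ) : ∫ ω, ω p ∂gaussianSource = 0 := by
  have h : ∫ x, x ∂(gaussianSource.map fun ω => ω p) = ∫ ω, ω p ∂gaussianSource :=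
    integral_map (measurable_pi_apply p).aemeasurable (by fun_prop)
  rw [← h, map_eval_gaussianSource, integral_id_gaussianReal]

theorem covariance_eval (p q : ℕ × ℕ) :
    cov[fun ω => ω p, fun ω => ω q; gaussianSource] = if p = q then 1 else 0 := by
  split_ifs with h
  · subst h
    rw [covariance_self (measurable_pi_apply p).aemeasurable,
      ← variance_id_map (measurable_pi_apply p).aemeasurable, map_eval_gaussianSource,
      variance_id_gaussianReal]
    simp
  · exact (iIndepFun_eval.indepFun h).covariance_eq_zero (hasGaussianLaw_eval p).memLp_two
      (hasGaussianLaw_eval q).memLp_two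

/-- Joint Gaussianity of the matrix of filters passes to all its linear images, for which being
uncorrelated implies being independent. -/
theorem hasGaussianLaw_pi_eval (m d : ℕ) :
    HasGaussianLaw (fun (ω : ℕ × ℕ → ℝ) (p : Fin m × Fin d) => ω (p.1.val, p.2.val))
      gaussianSource := by
  refine iIndepFun.hasGaussianLaw
    (X := fun (p : Fin m × Fin d) (ω : ℕ × ℕ → ℝ) => ω (p.1.val, p.2.val))
    (fun p => hasGaussianLaw_eval _) ?_
  refine iIndepFun_eval.precomp (g := fun p : Fin m × Fin d => (p.1.val, p.2.val)) ?_
  rintro ⟨a, b⟩ ⟨a', b'⟩ h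
  simp only [Prod.mk.injEq] at h
  exact Prod.ext (Fin.ext h.1) (Fin.ext h.2)

/-- The inner products with `v` of the rows of a matrix, as a continuous linear map. -/
noncomputable def scoreCLM (m : ℕ) {d : ℕ} (v : Fin d → ℝ) :
    (Fin m × Fin d → ℝ) →L[ℝ] (Fin m → ℝ) :=
  ContinuousLinearMap.pi fun i => ∑ j, v j • ContinuousLinearMap.proj (i, j)

theorem scoreCLM_apply (m : ℕ) {d : ℕ} (v : Fin d → ℝ) (ω : ℕ × ℕ → ℝ) (i : Fin m) :
    scoreCLM m v (fun p => ω (p.1.val, p.2.val)) i = score v i ω := by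
  simp [scoreCLM, score, mul_comm]

@[fun_prop]
theorem measurable_score {d : ℕ} (v : Fin d → ℝ) (i : ℕ) : Measurable (score v i) := by
  unfold score; fun_prop

theorem hasGaussianLaw_score_pi (m : ℕ) {d : ℕ} (v : Fin d → ℝ) :
    HasGaussianLaw (fun ω (i : Fin m) => score v i ω) gaussianSource := by
  have := (hasGaussianLaw_pi_eval m d).map_fun (scoreCLM m v)
  simpa only [← scoreCLM_apply] using! this

theorem hasGaussianLaw_score {d : ℕ} (v : Fin d → ℝ) (i : ℕ) :
    HasGaussianLaw (score v i) gaussianSource :=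
  (hasGaussianLaw_score_pi (i + 1) v).eval (Fin.last i)

theorem integral_score {d : ℕ} (v : Fin d → ℝ) (i : ℕ) :
    ∫ ω, score v i ω ∂gaussianSource = 0 := by
  unfold score
  rw [integral_finsetSum _ fun j _ => ((hasGaussianLaw_eval _).integrable.mul_const _)]
  simp [integral_mul_const, integral_eval]

theorem covariance_score {d : ℕ} (u v : Fin d → ℝ) (i j : ℕ) :
    cov[score u i, score v j; gaussianSource] = if i = j then ∑ k, u k * v k else 0 := by
  have h : ∀ (w : Fin d → ℝ) (l : ℕ) (k : Fin d),
      MemLp (fun ω : ℕ × ℕ → ℝ => ω (l, k.val) * w k) 2 gaussianSource := fun w l k =>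
    (hasGaussianLaw_eval _).memLp_two.mul_const _
  unfold score
  rw [covariance_fun_sum_fun_sum (h u i) (h v j)]
  simp only [covariance_mul_const_left, covariance_mul_const_right, covariance_eval,
    Prod.mk.injEq, Fin.val_inj]
  split_ifs with hij
  · simp [hij, mul_comm]
  · simp [hij]

theorem map_score {d : ℕ} (v : Fin d → ℝ) (i : ℕ) :
    gaussianSource.map (score v i) = gaussianReal 0 (∑ k, v k ^ 2).toNNReal := by
  rw [(hasGaussianLaw_score v i).map_eq_gaussianReal, integral_score,
    ← covariance_self (by fun_prop), covariance_score]
  simp [sq]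

theorem iIndepFun_score (m : ℕ) {d : ℕ} (v : Fin d → ℝ) :
    iIndepFun (fun (i : Fin m) ω => score v i ω) gaussianSource := by
  refine (hasGaussianLaw_score_pi m v).iIndepFun_of_covariance_eq_zero fun i j hij => ?_
  have := covariance_score v v i j
  rwa [if_neg (fun h => hij (Fin.ext h))] at this

/-- Both families are linear images of one Gaussian matrix. Different rows are uncorrelated, and
within a row the covariance is the inner product of the two vectors, here zero. -/
theorem indepFun_score (m : ℕ) {d : ℕ} (u v : Fin d → ℝ) (huv : ∑ k, u k * v k = 0) :
    IndepFun (fun ω (i : Fin m) => score u i ω) (fun ω (i : Fin m) => score v i ω)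
      gaussianSource := by
  refine HasGaussianLaw.indepFun_of_covariance_eval (X := fun (i : Fin m) ω => score u i ω)
    (Y := fun (i : Fin m) ω => score v i ω) ?_ fun i j => ?_
  · have := (hasGaussianLaw_pi_eval m d).map_fun ((scoreCLM m u).prod (scoreCLM m v))
    simpa only [← scoreCLM_apply] using! this
  · have := covariance_score u v i j
    rwa [huv, ite_self] at this

/-- Chernoff bound. An upper bound `V` on the variance suffices, which lets residual variances be
replaced by simpler quantities. For `V = 0` the quotient is 0 and the bound is the trivial 1. -/
theorem measure_le_score_le {d : ℕ} (v : Fin d → ℝ) (i : ℕ) {V t : ℝ} (hv : ∑ k, v k ^ 2 ≤ V)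
    (ht : 0 ≤ t) :
    gaussianSource {ω | t ≤ score v i ω} ≤ ENNReal.ofReal (Real.exp (-t ^ 2 / (2 * V))) := by
  have hV : 0 ≤ V := (Finset.sum_nonneg fun k _ => sq_nonneg (v k)).trans hv
  have h : HasSubgaussianMGF (score v i) V.toNNReal gaussianSource := by
    refine ⟨fun s => ?_, fun s => ?_⟩
    · have h1 := integrable_exp_mul_gaussianReal (μ := 0) (v := (∑ k, v k ^ 2).toNNReal) s
      rw [← map_score v i] at h1
      exact h1.comp_measurable (measurable_score v i)
    · rw [mgf_gaussianReal (map_score v i), Real.exp_le_exp, Real.coe_toNNReal _ hV,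
        Real.coe_toNNReal _ (Finset.sum_nonneg fun k _ => sq_nonneg (v k)), zero_mul, zero_add]
      gcongr
  have := h.measure_ge_le ht
  rw [Real.coe_toNNReal _ hV] at this
  rw [← ENNReal.ofReal_toReal (measure_ne_top gaussianSource _)]
  exact ENNReal.ofReal_le_ofReal this

theorem score_neg {d : ℕ} (v : Fin d → ℝ) (i : ℕ) (ω : ℕ × ℕ → ℝ) :
    score (fun j => -v j) i ω = -score v i ω := by
  simp [score]

theorem measure_score_le_neg_le {d : ℕ} (v : Fin d → ℝ) (i : ℕ) {V t : ℝ}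
    (hv : ∑ k, v k ^ 2 ≤ V) (ht : 0 ≤ t) :
    gaussianSource {ω | score v i ω ≤ -t} ≤ ENNReal.ofReal (Real.exp (-t ^ 2 / (2 * V))) := by
  have := measure_le_score_le (fun j => -v j) i (V := V) (by simpa using hv) ht
  simpa only [score_neg, le_neg] using this

/-- The upper tail contains the interval from t to t + δ, on which the density is at least its value
at the right end. -/
theorem gaussianReal_Iio_le {t δ : ℝ} (ht : 0 ≤ t) (hδ : 0 ≤ δ) :
    (gaussianReal 0 1).real (Set.Iio t) ≤
      1 - δ / √(2 * Real.pi) * Real.exp (-(t + δ) ^ 2 / 2) := by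
  have h1 : (gaussianReal 0 1).real (Set.Iio t) = 1 - (gaussianReal 0 1).real (Set.Ici t) := by
    rw [← Set.compl_Ici, probReal_compl_eq_one_sub measurableSet_Ici]
  have h2 : (gaussianReal 0 1).real (Set.Icc t (t + δ)) ≤ (gaussianReal 0 1).real (Set.Ici t) :=
    measureReal_mono Set.Icc_subset_Ici_self
  have h3 : (gaussianReal 0 1).real (Set.Icc t (t + δ)) =
      ∫ x in Set.Icc t (t + δ), gaussianPDFReal 0 1 x := by
    rw [measureReal_def, gaussianReal_apply_eq_integral _ one_ne_zero, ENNReal.toReal_ofReal]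
    exact setIntegral_nonneg measurableSet_Icc fun x _ => gaussianPDFReal_nonneg _ _ _
  have h4 : ∫ _x in Set.Icc t (t + δ), (√(2 * Real.pi))⁻¹ * Real.exp (-(t + δ) ^ 2 / 2) ≤
      ∫ x in Set.Icc t (t + δ), gaussianPDFReal 0 1 x := by
    refine setIntegral_mono_on (integrableOn_const (by simp))
      (integrable_gaussianPDFReal 0 1).integrableOn
      measurableSet_Icc fun x hx => ?_
    simp only [gaussianPDFReal, NNReal.coe_one, mul_one, sub_zero]
    gcongr
    · exact ht.trans hx.1
    · exact hx.2
  rw [setIntegral_const, Real.volume_real_Icc_of_le (by linarith), smul_eq_mul] at h4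
  have h5 : δ / √(2 * Real.pi) * Real.exp (-(t + δ) ^ 2 / 2) =
      (t + δ - t) * ((√(2 * Real.pi))⁻¹ * Real.exp (-(t + δ) ^ 2 / 2)) := by ring
  linarith

/-- Independence of the rows turns the probability into an m-th power, and 1 - p ≤ exp(-p). -/
theorem measure_forall_score_lt_le (m : ℕ) {d : ℕ} (v : Fin d → ℝ) (hv : ∑ k, v k ^ 2 = 1)
    {t δ : ℝ} (ht : 0 ≤ t) (hδ : 0 ≤ δ) :
    gaussianSource {ω | ∀ i : Fin m, score v i ω < t} ≤
      ENNReal.ofReal (Real.exp (-(m * (δ / √(2 * Real.pi) * Real.exp (-(t + δ) ^ 2 / 2))))) := by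
  set p := δ / √(2 * Real.pi) * Real.exp (-(t + δ) ^ 2 / 2) with hp
  have h0 : {ω | ∀ i : Fin m, score v i ω < t} =
      ⋂ i ∈ (Finset.univ : Finset (Fin m)), (fun ω => score v i ω) ⁻¹' Set.Iio t := by
    ext ω; simp
  have h1 : ∀ i : Fin m, gaussianSource ((fun ω => score v i ω) ⁻¹' Set.Iio t) ≤
      ENNReal.ofReal (Real.exp (-p)) := fun i => by
    rw [← Measure.map_apply (by fun_prop) measurableSet_Iio, map_score, hv, Real.toNNReal_one,
      ← ENNReal.ofReal_toReal (measure_ne_top (gaussianReal 0 1) _)]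
    refine ENNReal.ofReal_le_ofReal ((gaussianReal_Iio_le ht hδ).trans ?_)
    have := Real.add_one_le_exp (-p)
    linarith
  rw [h0, (iIndepFun_score m v).measure_inter_preimage_eq_mul _ (fun i _ => measurableSet_Iio)]
  refine (Finset.prod_le_prod' fun i _ => h1 i).trans (le_of_eq ?_)
  rw [Finset.prod_const, Finset.card_univ, Fintype.card_fin,
    ← ENNReal.ofReal_pow (Real.exp_pos _).le, ← Real.exp_nat_mul, mul_neg]

theorem measurableSet_isFirstMax {m : ℕ} (i : Fin m) :
    MeasurableSet {X : Fin m → ℝ | IsFirstMax X i} := by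
  simp only [IsFirstMax, Set.ofPred_and, Set.ofPred_forall]
  refine (MeasurableSet.iInter fun j => ?_).inter
    (MeasurableSet.iInter fun j => MeasurableSet.iInter fun _ => ?_)
  · exact measurableSet_le (by fun_prop) (by fun_prop)
  · exact measurableSet_lt (by fun_prop) (by fun_prop)

/-- The winning index is determined by the scores of `u`, which are independent of those of `v`.
Splitting over the winner gives a sum of products P(i wins) · p, and the disjoint winning events
have total mass at most 1. -/
theorem measure_exists_isFirstMax_le (m : ℕ) {d : ℕ} (u v : Fin d → ℝ)
    (huv : ∑ k, u k * v k = 0) {B : Set ℝ} (hB : MeasurableSet B) {p : ENNReal}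
    (hp : ∀ i, gaussianSource {ω | score v i ω ∈ B} ≤ p) :
    gaussianSource {ω | ∃ i : Fin m, IsFirstMax (fun i : Fin m => score u i ω) i ∧
      score v i ω ∈ B} ≤ p := by
  set F : Fin m → Set (ℕ × ℕ → ℝ) := fun i =>
    (fun ω (i : Fin m) => score u i ω) ⁻¹' {X | IsFirstMax X i} with hF
  have hFm : ∀ i, MeasurableSet (F i) := fun i =>
    (measurableSet_isFirstMax i).preimage (by fun_prop)
  have h0 : {ω | ∃ i : Fin m, IsFirstMax (fun i : Fin m => score u i ω) i ∧ score v i ω ∈ B} =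
      ⋃ i : Fin m, F i ∩ (fun ω (i : Fin m) => score v i ω) ⁻¹' {Y | Y i ∈ B} := by
    ext ω; simp [hF]
  have h1 : ∀ i : Fin m,
      gaussianSource (F i ∩ (fun ω (i : Fin m) => score v i ω) ⁻¹' {Y | Y i ∈ B}) ≤
        gaussianSource (F i) * p := fun i => by
    rw [(indepFun_score m u v huv).measure_inter_preimage_eq_mul _ {Y | Y i ∈ B}
      (measurableSet_isFirstMax i) (hB.preimage (measurable_pi_apply i))]
    exact mul_le_mul_right (hp i) _
  have h2 : ∑ i, gaussianSource (F i) ≤ 1 := by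
    rw [← tsum_fintype (L := .unconditional _), ← measure_iUnion _ hFm]
    · exact prob_le_one
    · intro i j hij
      refine Set.disjoint_left.2 fun ω hi hj => hij ?_
      exact IsFirstMax.unique hi hj
  rw [h0]
  refine (measure_iUnion_fintype_le _ _).trans ((Finset.sum_le_sum fun i _ => h1 i).trans ?_)
  rw [← Finset.sum_mul]
  exact (mul_le_mul_left h2 p).trans (one_mul p).le

end Top1

/-! ### Inspection probabilities of close and far points -/

namespace Top1

theorem sum_coords_sq {d : ℕ} (x : UnitSphere d) : ∑ j, coords x j ^ 2 = 1 := by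
  have h : ‖(x : EuclideanSpace ℝ (Fin d))‖ = 1 := by simp
  have h2 := EuclideanSpace.real_norm_sq_eq (x : EuclideanSpace ℝ (Fin d))
  rw [h, one_pow] at h2
  exact h2.symm

section Decomposition

variable {d : ℕ} (x q : Fin d → ℝ) (s : ℝ)

/-- When x is a unit vector and s its inner product with q, this is the split of q into its
projection on x and a residual orthogonal to x, so the two terms are independent. -/
theorem score_eq_add (i : ℕ) (ω : ℕ × ℕ → ℝ) :
    score q i ω = s * score x i ω + score (fun j => q j - s * x j) i ω := by
  simp only [score, Finset.mul_sum, ← Finset.sum_add_distrib]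
  exact Finset.sum_congr rfl fun j _ => by ring

theorem sum_mul_residual (hx : ∑ j, x j ^ 2 = 1) (hs : ∑ j, q j * x j = s) :
    ∑ j, x j * (q j - s * x j) = 0 := by
  have : ∑ j, x j * (q j - s * x j) = ∑ j, q j * x j - s * ∑ j, x j ^ 2 := by
    rw [Finset.mul_sum, ← Finset.sum_sub_distrib]
    exact Finset.sum_congr rfl fun j _ => by ring
  rw [this, hx, hs]; ring

theorem sum_linearCombination_sq (hx : ∑ j, x j ^ 2 = 1) (hq : ∑ j, q j ^ 2 = 1)
    (hs : ∑ j, q j * x j = s) (a b : ℝ) :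
    ∑ j, (a * x j + b * q j) ^ 2 = a ^ 2 + 2 * a * b * s + b ^ 2 := by
  have : ∑ j, (a * x j + b * q j) ^ 2 =
      a ^ 2 * ∑ j, x j ^ 2 + 2 * a * b * ∑ j, q j * x j + b ^ 2 * ∑ j, q j ^ 2 := by
    simp only [Finset.mul_sum, ← Finset.sum_add_distrib]
    exact Finset.sum_congr rfl fun j _ => by ring
  rw [this, hx, hs, hq]; ring

theorem sum_residual_sq (hx : ∑ j, x j ^ 2 = 1) (hq : ∑ j, q j ^ 2 = 1)
    (hs : ∑ j, q j * x j = s) : ∑ j, (q j - s * x j) ^ 2 = 1 - s ^ 2 := by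
  have := sum_linearCombination_sq x q s hx hq hs (-s) 1
  rw [show 1 - s ^ 2 = (-s) ^ 2 + 2 * -s * 1 * s + 1 ^ 2 by ring, ← this]
  exact Finset.sum_congr rfl fun j _ => by ring

end Decomposition

/-- The bucket of a point with similarity at least `α` to the query is missed only if the largest
score of the point is small, or if the residual score of the query in this bucket is small. -/
theorem measure_not_inspected_le {m d : ℕ} (hm : 0 < m) {x q : Fin d → ℝ} {s α η t δ τ : ℝ}
    (hx : ∑ j, x j ^ 2 = 1) (hq : ∑ j, q j ^ 2 = 1) (hs : ∑ j, q j * x j = s)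
    (hα : 0 < α) (hαs : α ≤ s) (ht : 0 ≤ t) (hδ : 0 ≤ δ) (hτ : 0 ≤ τ) (hη : η + τ ≤ α * t) :
    gaussianSource {ω | ¬ ∃ i : Fin m, IsFirstMax (fun i : Fin m => score x i ω) i ∧
        η ≤ score q i ω} ≤
      ENNReal.ofReal (Real.exp (-(m * (δ / √(2 * Real.pi) * Real.exp (-(t + δ) ^ 2 / 2)))) +
        Real.exp (-τ ^ 2 / (2 * (1 - α ^ 2)))) := by
  rw [ENNReal.ofReal_add (Real.exp_pos _).le (Real.exp_pos _).le]
  set w : Fin d → ℝ := fun j => q j - s * x j with hw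
  refine le_trans (measure_mono ?_) ((measure_union_le
    {ω | ∀ i : Fin m, score x i ω < t}
    {ω | ∃ i : Fin m, IsFirstMax (fun i : Fin m => score x i ω) i ∧
      score w i ω ∈ Set.Iic (-τ)}).trans (add_le_add
      (measure_forall_score_lt_le m x hx ht hδ)
      (measure_exists_isFirstMax_le m x w (sum_mul_residual x q s hx hs) measurableSet_Iic
        fun i => measure_score_le_neg_le w i ?_ hτ)))
  · intro ω hω
    obtain ⟨i, hi⟩ := exists_isFirstMax hm (fun i : Fin m => score x i ω)
    by_cases h : score x i ω < t
    · exact Or.inl fun j => (hi.1 j).trans_lt h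
    · refine Or.inr ⟨i, hi, ?_⟩
      have h1 : ¬ η ≤ score q i ω := fun h => hω ⟨i, hi, h⟩
      rw [score_eq_add x q s] at h1
      have h2 : α * t ≤ s * score x i ω :=
        mul_le_mul hαs (not_lt.1 h) ht (hα.le.trans hαs)
      change score w i ω ≤ -τ
      linarith
  · rw [sum_residual_sq x q s hx hq hs]
    nlinarith

/-- The probability that a point of similarity `s ≥ 0` to the query is inspected. -/
theorem measure_inspected_le_of_nonneg {m d : ℕ} {x q : Fin d → ℝ} {s η a : ℝ}
    (hx : ∑ j, x j ^ 2 = 1) (hq : ∑ j, q j ^ 2 = 1) (hs : ∑ j, q j * x j = s)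
    (hs0 : 0 ≤ s) (hs1 : s < 1) (ha : 0 ≤ a) (hηa : η ≤ a) :
    gaussianSource {ω | ∃ i : Fin m, IsFirstMax (fun i : Fin m => score x i ω) i ∧
        η ≤ score q i ω} ≤
      ENNReal.ofReal ((m * Real.exp (-a ^ 2 / 2) + 1) *
        Real.exp (-max (η - s * a) 0 ^ 2 / (2 * (1 - s ^ 2)))) := by
  -- If η ≤ s a, there is no gap to make up and the right-hand side is at least 1.
  rcases le_total (η - s * a) 0 with h | h
  · rw [max_eq_right h]
    refine prob_le_one.trans ?_
    rw [← ENNReal.ofReal_one]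
    refine ENNReal.ofReal_le_ofReal ?_
    simp only [ne_eq, OfNat.ofNat_ne_zero, not_false_eq_true, zero_pow, neg_zero, zero_div,
      Real.exp_zero, mul_one]
    have : 0 ≤ m * Real.exp (-a ^ 2 / 2) := by positivity
    linarith
  rw [max_eq_left h]
  have hsq : 0 < 1 - s ^ 2 := by nlinarith
  have hη0 : 0 ≤ η := by nlinarith
  set w : Fin d → ℝ := fun j => q j - s * x j with hw
  -- Up to the factor 1 - s², (c, e) is the inverse covariance matrix of the two scores applied to
  -- the corner (a, η). With these nonnegative weights the quadrant lies in a half-plane whose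
  -- Chernoff bound has exactly the exponent of the corner.
  set c := a - s * η with hc
  set e := η - s * a with he
  have hc0 : 0 ≤ c := by nlinarith
  have hD : c * a + e * η = e ^ 2 + (1 - s ^ 2) * a ^ 2 := by rw [hc, he]; ring
  set D := c * a + e * η with hDdef
  have hD0 : 0 ≤ D := by rw [hD]; positivity
  have hsum : ∑ j, (c * x j + e * q j) ^ 2 = (1 - s ^ 2) * D := by
    rw [sum_linearCombination_sq x q s hx hq hs, hD, hc, he]; ring
  have hone : ∀ i : ℕ, gaussianSource {ω | a ≤ score x i ω ∧ η ≤ score q i ω} ≤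
      ENNReal.ofReal (Real.exp (-a ^ 2 / 2) * Real.exp (-e ^ 2 / (2 * (1 - s ^ 2)))) := by
    intro i
    refine (measure_mono ?_).trans
      ((measure_le_score_le (fun j => c * x j + e * q j) i hsum.le hD0).trans
        (ENNReal.ofReal_le_ofReal ?_))
    · rintro ω ⟨h1, h2⟩
      have : score (fun j => c * x j + e * q j) i ω = c * score x i ω + e * score q i ω := by
        simp only [score, Finset.mul_sum, ← Finset.sum_add_distrib]
        exact Finset.sum_congr rfl fun j _ => by ring
      change D ≤ _
      rw [this]
      exact add_le_add (mul_le_mul_of_nonneg_left h1 hc0) (mul_le_mul_of_nonneg_left h2 h)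
    · rw [← Real.exp_add, Real.exp_le_exp]
      -- If D = 0, the variance bound vanishes and the left exponent is 0 by division by zero; the
      -- identity for D then forces e = a = 0, so the right exponent is 0 as well.
      rcases eq_or_ne D 0 with h0 | h0
      · have h1 : e ^ 2 = 0 := by nlinarith [sq_nonneg e, mul_nonneg hsq.le (sq_nonneg a)]
        have h2 : a ^ 2 = 0 := by
          have : (1 - s ^ 2) * a ^ 2 = 0 := by linarith
          exact (mul_eq_zero.1 this).resolve_left hsq.ne'
        simp [h0, h1, h2]
      · refine le_of_eq ?_
        have : -D ^ 2 / (2 * ((1 - s ^ 2) * D)) = -D / (2 * (1 - s ^ 2)) := by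
          field_simp
        rw [this, hD]
        field_simp
        ring
  rw [add_mul, one_mul, ENNReal.ofReal_add (by positivity) (Real.exp_pos _).le]
  -- Either the winning score of x reaches a, which is paid for by a union bound over the filters,
  -- or it contributes less than s a and the residual must supply e.
  refine le_trans (measure_mono ?_) ((measure_union_le
    (⋃ i : Fin m, {ω | a ≤ score x i ω ∧ η ≤ score q i ω})
    {ω | ∃ i : Fin m, IsFirstMax (fun i : Fin m => score x i ω) i ∧
      score w i ω ∈ Set.Ici e}).trans (add_le_add
      ((measure_iUnion_fintype_le _ _).trans ((Finset.sum_le_sum fun (i : Fin m) _ => hone i).trans ?_))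
      (measure_exists_isFirstMax_le m x w (sum_mul_residual x q s hx hs) measurableSet_Ici
        fun i => measure_le_score_le w i (sum_residual_sq x q s hx hq hs).le h)))
  · rintro ω ⟨i, hi, h1⟩
    by_cases h2 : a ≤ score x i ω
    · exact Or.inl (Set.mem_iUnion.2 ⟨i, h2, h1⟩)
    · refine Or.inr ⟨i, hi, ?_⟩
      rw [score_eq_add x q s] at h1
      have : s * score x i ω ≤ s * a := mul_le_mul_of_nonneg_left (not_le.1 h2).le hs0
      change e ≤ score w i ω
      linarith
  · rw [Finset.sum_const, Finset.card_univ, Fintype.card_fin, nsmul_eq_mul,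
      ← ENNReal.ofReal_natCast, ← ENNReal.ofReal_mul (by positivity), mul_assoc]

/-- The probability that a point of negative similarity to the query is inspected. -/
theorem measure_inspected_le_of_neg {m d : ℕ} {x q : Fin d → ℝ} {s η : ℝ}
    (hx : ∑ j, x j ^ 2 = 1) (hq : ∑ j, q j ^ 2 = 1) (hs : ∑ j, q j * x j = s) (hs0 : s < 0) :
    gaussianSource {ω | ∃ i : Fin m, IsFirstMax (fun i : Fin m => score x i ω) i ∧
        η ≤ score q i ω} ≤
      ENNReal.ofReal (Real.exp (-(m * (1 / √(2 * Real.pi) * Real.exp (-(0 + 1) ^ 2 / 2)))) +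
        Real.exp (-max η 0 ^ 2 / 2)) := by
  rw [ENNReal.ofReal_add (Real.exp_pos _).le (Real.exp_pos _).le]
  rcases le_total η 0 with h | h
  · rw [max_eq_right h]
    refine prob_le_one.trans ?_
    simp
  rw [max_eq_left h]
  set w : Fin d → ℝ := fun j => q j - s * x j with hw
  -- A nonnegative winning score of x only lowers the score of q, so the residual alone must reach
  -- η. The other event, all scores of x negative, is bounded with t = 0 and δ = 1.
  refine le_trans (measure_mono ?_) ((measure_union_le
    {ω | ∀ i : Fin m, score x i ω < 0}
    {ω | ∃ i : Fin m, IsFirstMax (fun i : Fin m => score x i ω) i ∧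
      score w i ω ∈ Set.Ici η}).trans (add_le_add
      (measure_forall_score_lt_le m x hx le_rfl zero_le_one)
      (measure_exists_isFirstMax_le m x w (sum_mul_residual x q s hx hs) measurableSet_Ici
        fun i => (measure_le_score_le w i (V := 1) ?_ h).trans (by rw [mul_one]))))
  · rintro ω ⟨i, hi, h1⟩
    by_cases h2 : score x i ω < 0
    · exact Or.inl fun j => (hi.1 j).trans_lt h2
    · refine Or.inr ⟨i, hi, ?_⟩
      rw [score_eq_add x q s] at h1
      have : s * score x i ω ≤ 0 := mul_nonpos_of_nonpos_of_nonneg hs0.le (not_lt.1 h2)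
      change η ≤ score w i ω
      linarith
  · rw [sum_residual_sq x q s hx hq hs]
    nlinarith [sq_nonneg s]

theorem lintegral_numInspected_le {n d : ℕ} (α β : ℝ) (S : Fin n → UnitSphere d)
    (q : UnitSphere d) :
    ∫⁻ ω, (numInspected α β S q ω : ENNReal) ∂gaussianSource ≤
      ENNReal.ofReal (numFilters α β n *
        Real.exp (-max (eta α (numFilters α β n)) 0 ^ 2 / 2)) := by
  classical
  set m := numFilters α β n with hm
  set η := eta α m with hη
  have h1 : ∀ ω, (numInspected α β S q ω : ENNReal) =
      ∑ i : Fin m, {ω | η ≤ score (coords q) i ω}.indicator 1 ω := fun ω => by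
    rw [numInspected_eq]
    push_cast
    exact Finset.sum_congr rfl fun i _ => by simp [Set.indicator_apply, hη, hm]
  have hmeas : ∀ i : Fin m, MeasurableSet {ω | η ≤ score (coords q) i ω} := fun i =>
    measurableSet_le measurable_const (measurable_score _ _)
  simp_rw [h1]
  rw [lintegral_finsetSum _ fun i _ => measurable_one.indicator (hmeas i)]
  simp_rw [fun i : Fin m => lintegral_indicator_one (μ := gaussianSource) (hmeas i)]
  have h2 : ∀ i : Fin m, gaussianSource {ω | η ≤ score (coords q) i ω} ≤
      ENNReal.ofReal (Real.exp (-max η 0 ^ 2 / 2)) := fun i => by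
    rcases le_total η 0 with h | h
    · rw [max_eq_right h]
      exact prob_le_one.trans (by simp)
    · rw [max_eq_left h]
      simpa using measure_le_score_le (coords q) i (sum_coords_sq q).le h
  refine (Finset.sum_le_sum fun i _ => h2 i).trans (le_of_eq ?_)
  rw [Finset.sum_const, Finset.card_univ, Fintype.card_fin, nsmul_eq_mul,
      ← ENNReal.ofReal_natCast, ← ENNReal.ofReal_mul (by positivity)]

theorem lintegral_numFar_le {n d : ℕ} {α β : ℝ} {S : Fin n → UnitSphere d} {q : UnitSphere d}
    {B : ENNReal}
    (h : ∀ k, sim q (S k) < β → gaussianSource {ω | Inspected α β S q ω k} ≤ B) :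
    ∫⁻ ω, (numFar α β S q ω : ENNReal) ∂gaussianSource ≤ n * B := by
  classical
  -- Measurable hulls have the same measure and allow exchanging sum and integral without proving
  -- the events measurable.
  set E : Fin n → Set (ℕ × ℕ → ℝ) := fun k =>
    toMeasurable gaussianSource {ω | sim q (S k) < β ∧ Inspected α β S q ω k} with hE
  have h1 : ∀ ω, (numFar α β S q ω : ENNReal) ≤ ∑ k, (E k).indicator 1 ω := fun ω => by
    rw [numFar, Set.ncard_eq_toFinset_card', Finset.card_eq_sum_ones, Nat.cast_sum]
    refine (Finset.sum_le_sum fun k hk => ?_).trans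
      (Finset.sum_le_sum_of_subset (f := fun k => (E k).indicator 1 ω) (Finset.subset_univ _))
    have : ω ∈ E k := subset_toMeasurable _ _ (by simpa using hk)
    simp [this]
  refine (lintegral_mono h1).trans ?_
  rw [lintegral_finsetSum _ fun k _ => measurable_one.indicator (measurableSet_toMeasurable _ _)]
  have h2 : ∀ k, gaussianSource {ω | sim q (S k) < β ∧ Inspected α β S q ω k} ≤ B := fun k => by
    by_cases hk : sim q (S k) < β
    · simpa [hk] using h k hk
    · simp [hk]
  trans ∑ _k : Fin n, B
  swap
  · simp
  refine Finset.sum_le_sum fun k _ => ?_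
  rw [lintegral_indicator_one (measurableSet_toMeasurable _ _), measure_toMeasurable]
  exact h2 k

end Top1

/-! ### Algebra of the exponents and the size of m -/

namespace Top1

section Parameters

variable {α β : ℝ} {n : ℕ}

theorem one_sub_mul_pos (hβ : 0 < β) (hβα : β < α) (hα : α < 1) : 0 < 1 - α * β := by nlinarith

theorem rho_div (hβ : 0 < β) (hβα : β < α) (hα : α < 1) :
    rho α β / (1 - α ^ 2) = (1 - β ^ 2) / (1 - α * β) ^ 2 := by
  have h1 : 1 - α ^ 2 ≠ 0 := by nlinarith
  have h2 := (one_sub_mul_pos hβ hβα hα).ne'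
  rw [rho]
  field_simp

/-- Rests on (1-αβ)² - (1-α²)(1-β²) = (α-β)². This is why the chosen m balances the two counts: n
m^(-(α-β)²/(1-β²)) and m^(1-α²) are both about n^ρ. -/
theorem one_sub_rho (hβ : 0 < β) (hβα : β < α) (hα : α < 1) :
    1 - rho α β = (α - β) ^ 2 / (1 - β ^ 2) * (rho α β / (1 - α ^ 2)) := by
  rw [rho_div hβ hβα hα, rho]
  have h1 : 1 - β ^ 2 ≠ 0 := by nlinarith
  have h2 := (one_sub_mul_pos hβ hβα hα).ne'
  field_simp
  ring

/-- Yields m ≥ n, so the filters dominate the stored points in the space and query bounds, and log m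
tends to infinity. -/
theorem one_le_rho_div (hβ : 0 < β) (hβα : β < α) (hα : α < 1) :
    1 ≤ rho α β / (1 - α ^ 2) := by
  have h := one_sub_mul_pos hβ hβα hα
  rw [rho_div hβ hβα hα, one_le_div (by positivity)]
  have h1 : 1 - α * β ≤ 1 - β ^ 2 := by nlinarith
  have h2 : 1 - α * β ≤ 1 := by nlinarith
  nlinarith

theorem rho_le_one (hβ : 0 < β) (hβα : β < α) (hα : α < 1) : rho α β ≤ 1 := by
  have h1 := one_sub_rho hβ hβα hα
  have h2 := one_le_rho_div hβ hβα hα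
  have h3 : 0 < 1 - β ^ 2 := by nlinarith
  have : 0 ≤ 1 - rho α β := by rw [h1]; positivity
  linarith

theorem rpow_le_numFilters (hβ : 0 < β) (hβα : β < α) (hα : α < 1) :
    (n : ℝ) ^ (rho α β / (1 - α ^ 2)) ≤ numFilters α β n := by
  rw [rho_div hβ hβα hα]
  exact Nat.le_ceil _

theorem le_rpow_rho_div (hβ : 0 < β) (hβα : β < α) (hα : α < 1) (hn : 1 ≤ n) :
    (n : ℝ) ≤ (n : ℝ) ^ (rho α β / (1 - α ^ 2)) :=
  Real.self_le_rpow_of_one_le (by exact_mod_cast hn) (one_le_rho_div hβ hβα hα)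

theorem le_numFilters (hβ : 0 < β) (hβα : β < α) (hα : α < 1) (hn : 1 ≤ n) :
    (n : ℝ) ≤ numFilters α β n :=
  (le_rpow_rho_div hβ hβα hα hn).trans (rpow_le_numFilters hβ hβα hα)

theorem numFilters_le (hβ : 0 < β) (hβα : β < α) (hα : α < 1) (hn : 1 ≤ n) :
    (numFilters α β n : ℝ) ≤ 2 * (n : ℝ) ^ (rho α β / (1 - α ^ 2)) := by
  have h1 : (1 : ℝ) ≤ n := by exact_mod_cast hn
  have h2 := le_rpow_rho_div hβ hβα hα hn
  rw [numFilters, ← rho_div hβ hβα hα]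
  have := Nat.ceil_lt_add_one (zero_le_one.trans (h1.trans h2))
  linarith

theorem mul_log_le_log_numFilters (hβ : 0 < β) (hβα : β < α) (hα : α < 1) (hn : 1 ≤ n) :
    rho α β / (1 - α ^ 2) * Real.log n ≤ Real.log (numFilters α β n) := by
  have h1 : (0 : ℝ) < n := by exact_mod_cast hn
  rw [← Real.log_rpow h1]
  exact Real.log_le_log (by positivity) (rpow_le_numFilters hβ hβα hα)

theorem log_le_log_numFilters (hβ : 0 < β) (hβα : β < α) (hα : α < 1) (hn : 1 ≤ n) :
    Real.log n ≤ Real.log (numFilters α β n) :=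
  Real.log_le_log (by exact_mod_cast hn) (le_numFilters hβ hβα hα hn)

/-- The logarithmic form of m^(1-α²) ≤ 2 n^ρ; the 2 pays for rounding up a number that is at least
1. -/
theorem mul_log_numFilters_le (hβ : 0 < β) (hβα : β < α) (hα : α < 1) (hn : 1 ≤ n) :
    (1 - α ^ 2) * Real.log (numFilters α β n) ≤ rho α β * Real.log n + Real.log 2 := by
  have h1 : (1 : ℝ) ≤ n := by exact_mod_cast hn
  have h2 : 0 < 1 - α ^ 2 := by nlinarith
  have h3 : Real.log (numFilters α β n) ≤
      Real.log 2 + rho α β / (1 - α ^ 2) * Real.log n := by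
    rw [← Real.log_rpow (by linarith), ← Real.log_mul (by norm_num) (by positivity)]
    exact Real.log_le_log (by linarith [le_numFilters hβ hβα hα hn])
      (numFilters_le hβ hβα hα hn)
  have h4 := Real.log_pos one_lt_two
  calc (1 - α ^ 2) * Real.log (numFilters α β n)
      ≤ (1 - α ^ 2) * (Real.log 2 + rho α β / (1 - α ^ 2) * Real.log n) := by gcongr
    _ = (1 - α ^ 2) * Real.log 2 + rho α β * Real.log n := by field_simp
    _ ≤ _ := by nlinarith

/-- The function `s ↦ (α - s)² / (1 - s²)` is decreasing on `[0, α]`. -/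
theorem sq_sub_div_antitone {s : ℝ} (hs : 0 ≤ s) (hsβ : s ≤ β) (hβα : β ≤ α) (hα : α < 1) :
    (α - β) ^ 2 / (1 - β ^ 2) ≤ (α - s) ^ 2 / (1 - s ^ 2) := by
  have h1 : 0 < 1 - β ^ 2 := by nlinarith
  have h2 : 0 < 1 - s ^ 2 := by nlinarith
  rw [div_le_div_iff₀ h1 h2]
  -- After cross-multiplication, the difference of the two sides is β - s times this expression.
  have h3 : 0 ≤ (α - β) * (1 - α * s) + (α - s) * (1 - α * β) := by
    have : 0 ≤ 1 - α * s := by nlinarith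
    have : 0 ≤ 1 - α * β := by nlinarith
    have : 0 ≤ α - β := by linarith
    have : 0 ≤ α - s := by linarith
    positivity
  nlinarith [mul_nonneg (sub_nonneg.2 hsβ) h3]

end Parameters

theorem sub_le_max_sub_sq {u v : ℝ} (hu : 0 ≤ u) (hv : 0 ≤ v) :
    u ^ 2 - 2 * (u * v) ≤ max (u - v) 0 ^ 2 := by
  rcases le_total (u - v) 0 with h | h
  · rw [max_eq_right h]; nlinarith
  · rw [max_eq_left h]; nlinarith

/-- The exponent of the lower-order factor `m ^ o(1)` of the bounds. -/
noncomputable def crossTerm (α : ℝ) (m : ℕ) : ℝ :=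
  √(2 * Real.log m) * √(2 * (1 - α ^ 2) * Real.log (Real.log m))

theorem crossTerm_nonneg (α : ℝ) (m : ℕ) : 0 ≤ crossTerm α m := by
  unfold crossTerm; positivity

/-- Expanding the square of (α-s) √(2 log m) minus the margin leaves the main exponent and a mixed
term with coefficient (α-s)/(1-s²), which is at most 1 because α - s ≤ 1 - s ≤ 1 - s². The case s =
0 serves the bucket count and negative similarities. -/
theorem neg_max_sq_div_le {α s : ℝ} {m : ℕ} (hs : 0 ≤ s) (hsα : s ≤ α) (hα : α < 1)
    (hL : 0 ≤ Real.log m) :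
    -max (eta α m - s * √(2 * Real.log m)) 0 ^ 2 / (2 * (1 - s ^ 2)) ≤
      -((α - s) ^ 2 / (1 - s ^ 2) * Real.log m) + crossTerm α m := by
  set a := √(2 * Real.log m) with ha
  set v := √(2 * (1 - α ^ 2) * Real.log (Real.log m)) with hv
  have h1 : 0 < 1 - s ^ 2 := by nlinarith
  have h2 : eta α m - s * a = (α - s) * a - v := by rw [eta]; ring
  have h3 := sub_le_max_sub_sq (u := (α - s) * a) (v := v)
    (mul_nonneg (by linarith) (Real.sqrt_nonneg _)) (Real.sqrt_nonneg _)
  have h4 : a ^ 2 = 2 * Real.log m := Real.sq_sqrt (by linarith)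
  have h5 : 0 ≤ a * v := by positivity
  have h6 : (α - s) * (a * v) ≤ (1 - s ^ 2) * (a * v) :=
    mul_le_mul_of_nonneg_right (by nlinarith) h5
  rw [h2, div_le_iff₀ (by linarith), crossTerm]
  have h7 : (-((α - s) ^ 2 / (1 - s ^ 2) * Real.log m) + a * v) * (2 * (1 - s ^ 2)) =
      -((α - s) ^ 2 * (2 * Real.log m)) + 2 * ((1 - s ^ 2) * (a * v)) := by
    field_simp
  rw [h7, ← h4]
  nlinarith

/-! ### Explicit bounds for fixed n -/

section Bounds

variable {α β : ℝ} {n : ℕ}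

theorem lintegral_numInspected_le_exp (hβ : 0 < β) (hβα : β < α) (hα : α < 1) (hn : 1 ≤ n)
    {d : ℕ} (S : Fin n → UnitSphere d) (q : UnitSphere d) :
    ∫⁻ ω, (numInspected α β S q ω : ENNReal) ∂gaussianSource ≤
      ENNReal.ofReal (Real.exp (rho α β * Real.log n + Real.log 2 +
        crossTerm α (numFilters α β n))) := by
  refine (lintegral_numInspected_le α β S q).trans (ENNReal.ofReal_le_ofReal ?_)
  set m := numFilters α β n with hm
  have h1 : (1 : ℝ) ≤ n := by exact_mod_cast hn
  have h2 : (1 : ℝ) ≤ m := h1.trans (le_numFilters hβ hβα hα hn)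
  have h3 := neg_max_sq_div_le (m := m) le_rfl (hβ.trans hβα).le hα (Real.log_nonneg h2)
  have h4 := mul_log_numFilters_le hβ hβα hα hn
  rw [← hm] at h4
  nth_rw 1 [← Real.exp_log (zero_lt_one.trans_le h2)]
  rw [← Real.exp_add, Real.exp_le_exp]
  simp only [zero_mul, sub_zero, ne_eq, OfNat.ofNat_ne_zero, not_false_eq_true, zero_pow,
    mul_one, div_one] at h3
  linarith

theorem measure_inspected_le_exp (hβ : 0 < β) (hβα : β < α) (hα : α < 1) (hn : 1 ≤ n)
    (hlog : Real.log n ≤ n * (1 / √(2 * Real.pi) * Real.exp (-(0 + 1) ^ 2 / 2)))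
    {d : ℕ} (S : Fin n → UnitSphere d) (q : UnitSphere d) (k : Fin n) (hk : sim q (S k) < β) :
    gaussianSource {ω | Inspected α β S q ω k} ≤
      ENNReal.ofReal (2 * Real.exp (-((1 - rho α β) * Real.log n) +
        crossTerm α (numFilters α β n))) := by
  simp only [inspected_iff]
  set m := numFilters α β n with hm
  have h1 : (1 : ℝ) ≤ n := by exact_mod_cast hn
  have h2 : (1 : ℝ) ≤ m := h1.trans (le_numFilters hβ hβα hα hn)
  have hlm : 0 ≤ Real.log m := Real.log_nonneg h2
  have hT := crossTerm_nonneg α m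
  have hx := sum_coords_sq (S k)
  have hq := sum_coords_sq q
  have hs := (sim_eq_sum q (S k)).symm
  have hmain : ∀ s, 0 ≤ s → s ≤ β →
      Real.exp (-max (eta α m - s * √(2 * Real.log m)) 0 ^ 2 / (2 * (1 - s ^ 2))) ≤
        Real.exp (-((1 - rho α β) * Real.log n) + crossTerm α m) := by
    intro s hs0 hsβ
    rw [Real.exp_le_exp]
    refine (neg_max_sq_div_le hs0 (hsβ.trans hβα.le) hα hlm).trans ?_
    have h3 := sq_sub_div_antitone hs0 hsβ hβα.le hα
    have h4 := mul_log_le_log_numFilters hβ hβα hα hn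
    have h5 : 0 ≤ (α - β) ^ 2 / (1 - β ^ 2) :=
      div_nonneg (sq_nonneg _) (by nlinarith)
    have h6 : (1 - rho α β) * Real.log n ≤ (α - β) ^ 2 / (1 - β ^ 2) * Real.log m := by
      rw [one_sub_rho hβ hβα hα, mul_assoc]
      exact mul_le_mul_of_nonneg_left h4 h5
    have h7 := mul_le_mul_of_nonneg_right h3 hlm
    linarith
  rcases lt_or_ge (sim q (S k)) 0 with hs0 | hs0
  · refine (measure_inspected_le_of_neg hx hq hs hs0).trans (ENNReal.ofReal_le_ofReal ?_)
    have h3 := hmain 0 le_rfl hβ.le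
    simp only [zero_mul, sub_zero, ne_eq, OfNat.ofNat_ne_zero, not_false_eq_true, zero_pow,
      mul_one] at h3
    -- By `hlog` and n ≤ m, the event that all scores are negative has probability at most 1/n,
    -- which is at most n^(-(1-ρ)) since ρ ≥ 0.
    have h4 : Real.exp (-(m * (1 / √(2 * Real.pi) * Real.exp (-(0 + 1) ^ 2 / 2)))) ≤
        Real.exp (-((1 - rho α β) * Real.log n) + crossTerm α m) := by
      rw [Real.exp_le_exp]
      have h5 : (n : ℝ) * (1 / √(2 * Real.pi) * Real.exp (-(0 + 1) ^ 2 / 2)) ≤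
          m * (1 / √(2 * Real.pi) * Real.exp (-(0 + 1) ^ 2 / 2)) :=
        mul_le_mul_of_nonneg_right (le_numFilters hβ hβα hα hn) (by positivity)
      have h6 : 0 ≤ rho α β := by
        have : 0 ≤ 1 - α ^ 2 := by nlinarith
        have : 0 ≤ 1 - β ^ 2 := by nlinarith
        rw [rho]; positivity
      nlinarith [Real.log_nonneg h1]
    linarith
  · have ha : √(2 * Real.log m) ^ 2 = 2 * Real.log m := Real.sq_sqrt (by linarith)
    have hηa : eta α m ≤ √(2 * Real.log m) := by
      have := Real.sqrt_nonneg (2 * (1 - α ^ 2) * Real.log (Real.log m))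
      have : α * √(2 * Real.log m) ≤ 1 * √(2 * Real.log m) := by gcongr
      rw [eta]; linarith
    refine (measure_inspected_le_of_nonneg hx hq hs hs0 (by linarith) (Real.sqrt_nonneg _)
      hηa).trans (ENNReal.ofReal_le_ofReal ?_)
    -- The cut-off √(2 log m) equalizes the two far-point events: the union bound over m filters
    -- costs exactly a factor 1, hence the 2 in the bound.
    have h3 : (m : ℝ) * Real.exp (-√(2 * Real.log m) ^ 2 / 2) = 1 := by
      rw [ha, show -(2 * Real.log m) / 2 = -Real.log m by ring, Real.exp_neg,
        Real.exp_log (by linarith)]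
      exact mul_inv_cancel₀ (by linarith)
    rw [h3, one_add_one_eq_two]
    exact mul_le_mul_of_nonneg_left (hmain _ hs0 hk.le) zero_le_two

theorem lintegral_numFar_le_exp (hβ : 0 < β) (hβα : β < α) (hα : α < 1) (hn : 1 ≤ n)
    (hlog : Real.log n ≤ n * (1 / √(2 * Real.pi) * Real.exp (-(0 + 1) ^ 2 / 2)))
    {d : ℕ} (S : Fin n → UnitSphere d) (q : UnitSphere d) :
    ∫⁻ ω, (numFar α β S q ω : ENNReal) ∂gaussianSource ≤
      ENNReal.ofReal (Real.exp (rho α β * Real.log n + Real.log 2 +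
        crossTerm α (numFilters α β n))) := by
  refine (lintegral_numFar_le (measure_inspected_le_exp hβ hβα hα hn hlog S q)).trans
    (le_of_eq ?_)
  have h1 : (0 : ℝ) < n := by exact_mod_cast hn
  rw [← ENNReal.ofReal_natCast, ← ENNReal.ofReal_mul h1.le]
  congr 1
  nth_rw 1 [← Real.exp_log h1]
  nth_rw 1 [← Real.exp_log (zero_lt_two' ℝ)]
  rw [← Real.exp_add, ← Real.exp_add]
  congr 1
  ring

/-- With L = log m and l = log L, take t + δ = √(2(L - l)) and δ = 1/√L. Then m exp(-(t+δ)²/2) = L,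
so the exponent for a small maximum is √L/√(2π). The residual margin τ = √((1-α²) l) gives
exp(-l/2). -/
theorem measure_not_inspected_le_exp (hβ : 0 < β) (hβα : β < α) (hα : α < 1)
    (hL : 0 < Real.log (numFilters α β n))
    (hl : 1 ≤ Real.log (Real.log (numFilters α β n)))
    (hlL : 100 * Real.log (Real.log (numFilters α β n)) ≤
      (1 - α ^ 2) * Real.log (numFilters α β n))
    {d : ℕ} (S : Fin n → UnitSphere d) (q : UnitSphere d) (k : Fin n) (hk : α ≤ sim q (S k)) :
    gaussianSource {ω | ¬ Inspected α β S q ω k} ≤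
      ENNReal.ofReal (Real.exp (-(√(Real.log (numFilters α β n)) / √(2 * Real.pi))) +
        Real.exp (-(Real.log (Real.log (numFilters α β n)) / 2))) := by
  simp only [inspected_iff]
  set m := numFilters α β n with hm
  set L := Real.log m with hLdef
  set l := Real.log L with hldef
  have hα0 : 0 < α := hβ.trans hβα
  have hα2 : 0 < 1 - α ^ 2 := by nlinarith
  have hm0 : 0 < m := by
    rcases Nat.eq_zero_or_pos m with h | h
    · simp [hLdef, h] at hL
    · exact h
  have hm0' : (0 : ℝ) < m := by exact_mod_cast hm0
  have hlL' : 100 * l ≤ L := by nlinarith [sq_nonneg α]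
  have hL1 : 1 ≤ L := by linarith
  set σ := √L with hσ
  have hσ2 : σ ^ 2 = L := Real.sq_sqrt hL.le
  have hσ1 : 1 ≤ σ := Real.one_le_sqrt.2 hL1
  set r := √((1 - α ^ 2) * l) with hr
  have hr2 : r ^ 2 = (1 - α ^ 2) * l := Real.sq_sqrt (by positivity)
  have hr0 : 0 ≤ r := Real.sqrt_nonneg _
  set b := √(2 * (L - l)) with hb
  have hb2 : b ^ 2 = 2 * (L - l) := Real.sq_sqrt (by linarith)
  have hb0 : 0 ≤ b := Real.sqrt_nonneg _
  have hbσ : σ ≤ b := by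
    refine Real.sqrt_le_sqrt ?_
    linarith
  have ht : 0 ≤ b - 1 / σ := by
    have : 1 / σ ≤ 1 := by rw [div_le_one (by linarith)]; exact hσ1
    linarith
  have h2 : √2 ^ 2 = (2 : ℝ) := Real.sq_sqrt zero_le_two
  have h20 : (1.41 : ℝ) ≤ √2 := Real.le_sqrt_of_sq_le (by norm_num)
  have hv : √(2 * (1 - α ^ 2) * l) = √2 * r := by
    rw [mul_assoc, Real.sqrt_mul zero_le_two]
  have ha : √(2 * L) = √2 * σ := Real.sqrt_mul zero_le_two _
  have hlr : 10 * l ≤ r * σ := by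
    refine le_of_sq_le_sq ?_ (by positivity)
    rw [mul_pow, mul_pow, hr2, hσ2]
    nlinarith
  have hba : b ≤ √2 * σ := by rw [← ha]; exact Real.sqrt_le_sqrt (by linarith)
  have hgap : √2 * σ - b ≤ 2 * l / σ := by
    rw [le_div_iff₀ (by linarith)]
    have h3 : (√2 * σ - b) * (√2 * σ + b) = 2 * l := by
      have : (√2 * σ - b) * (√2 * σ + b) = √2 ^ 2 * σ ^ 2 - b ^ 2 := by ring
      rw [this, h2, hσ2, hb2]
      ring
    have h4 : σ ≤ √2 * σ + b := by nlinarith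
    calc (√2 * σ - b) * σ ≤ (√2 * σ - b) * (√2 * σ + b) :=
          mul_le_mul_of_nonneg_left h4 (by linarith)
      _ = 2 * l := h3
  -- The slack in η is √2 r - r ≥ 0.41 r. Lowering the cut-off from √2 σ to b - 1/σ costs at most
  -- (2l + 1)/σ ≤ 3l/σ ≤ 0.3 r, using l ≥ 1 and 10 l ≤ r σ; the latter is where the factor 100 in
  -- `hlL` is needed.
  have hη : eta α m + r ≤ α * (b - 1 / σ) := by
    have h3 : 2 * l / σ + 1 / σ ≤ 3 / 10 * r := by
      rw [← add_div, div_le_iff₀ (by linarith)]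
      linarith
    have h4 : α * (√2 * σ - b + 1 / σ) ≤ 1 * (3 / 10 * r) := by
      refine mul_le_mul hα.le (by linarith) ?_ zero_le_one
      have : 0 ≤ 1 / σ := by positivity
      linarith
    have h5 : eta α m = α * (√2 * σ) - √2 * r := by rw [eta, ha, hv]
    rw [h5]
    nlinarith
  have h := measure_not_inspected_le hm0 (sum_coords_sq (S k)) (sum_coords_sq q)
    (sim_eq_sum q (S k)).symm hα0 hk ht (δ := 1 / σ) (by positivity) hr0 hη
  refine h.trans (le_of_eq ?_)
  congr 3
  · rw [sub_add_cancel, hb2, show -(2 * (L - l)) / 2 = l - L by ring, Real.exp_sub, hldef,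
      Real.exp_log hL, hLdef, Real.exp_log hm0', ← hLdef, ← hσ2]
    field_simp
  · rw [hr2]
    field_simp

end Bounds

end Top1

/-! ### Worst-case costs as powers of n -/

namespace Top1

section Cost

variable {α β : ℝ} {n d : ℕ}

/-- The sphere is empty in dimension 0; otherwise the cost terms without a factor d could not be
absorbed. -/
theorem UnitSphere.one_le_dim (x : UnitSphere d) : 1 ≤ d := by
  rcases Nat.eq_zero_or_pos d with rfl | h
  · simpa using sum_coords_sq x
  · exact h

theorem build_steps_le_rpow (hβ : 0 < β) (hβα : β < α) (hα : α < 1) (hn : 1 ≤ n)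
    (S : Fin n → UnitSphere d) (ω : ℕ × ℕ → ℝ) :
    ((build α β S ω).steps : ℝ) ≤ 100 * (d * (n : ℝ) ^ (1 + rho α β / (1 - α ^ 2))) := by
  have hn' : (1 : ℝ) ≤ n := by exact_mod_cast hn
  have hd : (1 : ℝ) ≤ d := by exact_mod_cast UnitSphere.one_le_dim (S ⟨0, hn⟩)
  have h1 := le_numFilters hβ hβα hα hn
  have h2 := numFilters_le hβ hβα hα hn
  rw [Real.rpow_add (by linarith), Real.rpow_one]
  set R := (n : ℝ) ^ (rho α β / (1 - α ^ 2))
  have h3 : ((build α β S ω).steps : ℝ) ≤ 9 + numFilters α β n * (2 * d + 1) + n * (2 * d + 1) +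
      numFilters α β n + n * (numFilters α β n * (5 * d + 3) + 3) + 13 := by
    exact_mod_cast build_steps_le α β S ω
  set m : ℝ := (numFilters α β n : ℝ)
  have hm : 1 ≤ m := hn'.trans h1
  have e1 : m ≤ n * m := le_mul_of_one_le_left (by linarith) hn'
  have e2 : n * m ≤ d * (n * m) := le_mul_of_one_le_left (by nlinarith) hd
  have e3 : m * d ≤ d * (n * m) := by nlinarith
  have e4 : n * d ≤ d * (n * m) := by 
    nlinarith [mul_nonneg (show (0 : ℝ) ≤ d by linarith) (show (0 : ℝ) ≤ n by linarith)]
  have e5 : d * (n * m) ≤ d * (n * (2 * R)) := by gcongr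
  have e6 : (n : ℝ) ≤ n * m := le_mul_of_one_le_right (by linarith) hm
  have e7 : (1 : ℝ) ≤ n * m := by linarith
  calc _ ≤ _ := h3
    _ ≤ 50 * (d * (n * m)) := by nlinarith
    _ ≤ _ := by linarith

theorem space_le_rpow (hβ : 0 < β) (hβα : β < α) (hα : α < 1) (hn : 1 ≤ n)
    (S : Fin n → UnitSphere d) (ω : ℕ × ℕ → ℝ) :
    ((build α β S ω).val.space : ℝ) ≤ 100 * (d * (n : ℝ) ^ (rho α β / (1 - α ^ 2))) := by
  have hn' : (1 : ℝ) ≤ n := by exact_mod_cast hn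
  have hd : (1 : ℝ) ≤ d := by exact_mod_cast UnitSphere.one_le_dim (S ⟨0, hn⟩)
  have h1 := le_rpow_rho_div hβ hβα hα hn
  have h2 := numFilters_le hβ hβα hα hn
  set R := (n : ℝ) ^ (rho α β / (1 - α ^ 2))
  have h3 : (build α β S ω).val.space ≤
      numFilters α β n * d + n * d + (numFilters α β n + 2 * n) + 2 := by
    have h := sum_length_bucket_le α β S ω
    have hm : (build α β S ω).val.m = numFilters α β n := computeNumFilters_val α β n
    rw [DataStructure.space, Finset.sum_add_distrib, ← Finset.mul_sum, ← hm]
    simp only [Finset.sum_const, Finset.card_univ, Fintype.card_fin, smul_eq_mul, mul_one]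
    linarith
  have h4 : ((build α β S ω).val.space : ℝ) ≤
      numFilters α β n * d + n * d + (numFilters α β n + 2 * n) + 2 := by exact_mod_cast h3
  have e1 : (numFilters α β n : ℝ) * d ≤ 2 * R * d := by gcongr
  have e2 : (n : ℝ) * d ≤ R * d := by gcongr
  have e3 : R ≤ d * R := le_mul_of_one_le_left (by linarith) hd
  linarith

theorem query_steps_le_rpow (hβ : 0 < β) (hβα : β < α) (hα : α < 1) (hn : 1 ≤ n)
    (S : Fin n → UnitSphere d) (ω : ℕ × ℕ → ℝ) (q : UnitSphere d) :
    ((query (build α β S ω).val β (coords q)).steps : ℝ) ≤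
      100 * (d * (n : ℝ) ^ (rho α β / (1 - α ^ 2))) := by
  have hd : (1 : ℝ) ≤ d := by exact_mod_cast UnitSphere.one_le_dim q
  have h1 := le_rpow_rho_div hβ hβα hα hn
  have h2 := numFilters_le hβ hβα hα hn
  set R := (n : ℝ) ^ (rho α β / (1 - α ^ 2))
  have h3 : (query (build α β S ω).val β (coords q)).steps ≤
      numFilters α β n * (5 * d + 6) + n * (5 * d + 3) := by
    have h := query_steps_le (build α β S ω).val β (coords q)
    have hm : (build α β S ω).val.m = numFilters α β n := computeNumFilters_val α β n
    rw [← hm]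
    exact h.trans (Nat.add_le_add_left
      (Nat.mul_le_mul_right _ (sum_length_bucket_le α β S ω)) _)
  have h4 : ((query (build α β S ω).val β (coords q)).steps : ℝ) ≤
      numFilters α β n * (5 * d + 6) + n * (5 * d + 3) := by exact_mod_cast h3
  have e1 : (numFilters α β n : ℝ) * (5 * d + 6) ≤ 2 * R * (5 * d + 6) := by gcongr
  have e2 : (n : ℝ) * (5 * d + 3) ≤ R * (5 * d + 3) := by gcongr
  have hn' : (0 : ℝ) ≤ n := Nat.cast_nonneg n
  have e3 : R ≤ d * R := le_mul_of_one_le_left (by linarith) hd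
  linarith

end Cost

/-- The rate of convergence in the bounds. -/
noncomputable def rate (α β : ℝ) (n : ℕ) : ℝ :=
  (Real.log 2 + crossTerm α (numFilters α β n)) / Real.log n +
    (Real.exp (-(√(Real.log (numFilters α β n)) / √(2 * Real.pi))) +
      Real.exp (-(Real.log (Real.log (numFilters α β n)) / 2)))

/-! ### Convergence of the error terms -/

section Asymptotics

variable {α β : ℕ → ℝ} (h : ∀ n, 0 < β n ∧ β n < α n ∧ α n < 1)
include h

theorem tendsto_log_numFilters :
    Tendsto (fun n => Real.log (numFilters (α n) (β n) n)) atTop atTop := by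
  refine tendsto_atTop_mono' _ ?_ (Real.tendsto_log_atTop.comp tendsto_natCast_atTop_atTop)
  filter_upwards [eventually_ge_atTop 1] with n hn
  exact log_le_log_numFilters (h n).1 (h n).2.1 (h n).2.2 hn

theorem tendsto_crossTerm_div_log
    (hlog : (fun n : ℕ => Real.log (Real.log (numFilters (α n) (β n) n)) /
        Real.log (numFilters (α n) (β n) n)) =o[atTop] fun n => 1 - α n ^ 2) :
    Tendsto (fun n : ℕ => crossTerm (α n) (numFilters (α n) (β n) n) / Real.log n) atTop
      (𝓝 0) := by
  have hα2 : ∀ n, 0 < 1 - α n ^ 2 := fun n => by nlinarith [(h n).1, (h n).2.1, (h n).2.2]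
  have hκ := (isLittleO_iff_tendsto fun n hn => absurd hn (hα2 n).ne').1 hlog
  -- The 4 is 2 · 2: one 2 from rewriting the cross term in `h6`, the other from (1-α²) log m ≤ 2
  -- log n in `h4`, which uses ρ ≤ 1 and log 2 < 1 ≤ log n.
  have hκ' : Tendsto (fun n : ℕ => 4 * √(Real.log (Real.log (numFilters (α n) (β n) n)) /
      Real.log (numFilters (α n) (β n) n) / (1 - α n ^ 2))) atTop (𝓝 0) := by
    simpa using (hκ.sqrt).const_mul 4
  have hlogn : Tendsto (fun n : ℕ => Real.log n) atTop atTop :=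
    Real.tendsto_log_atTop.comp tendsto_natCast_atTop_atTop
  refine tendsto_of_tendsto_of_tendsto_of_le_of_le' tendsto_const_nhds hκ' ?_ ?_
  · filter_upwards [hlogn.eventually_gt_atTop 0] with n hn
    exact div_nonneg (crossTerm_nonneg _ _) hn.le
  · filter_upwards [hlogn.eventually_ge_atTop 1, eventually_ge_atTop 1,
      (tendsto_log_numFilters h).eventually_ge_atTop 1] with n hn1 hn hL
    obtain ⟨hβ, hβα, hα⟩ := h n
    have h1 := mul_log_numFilters_le hβ hβα hα hn
    have h2 := rho_le_one hβ hβα hα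
    have h3 := hα2 n
    have h5 := Real.log_two_lt_d9
    rw [crossTerm]
    set L := Real.log (numFilters (α n) (β n) n) with hLdef
    set l := Real.log L with hldef
    have hl : 0 ≤ l := Real.log_nonneg hL
    have h4 : (1 - α n ^ 2) * L ≤ 2 * Real.log n := by nlinarith
    have h6 : √(2 * L) * √(2 * (1 - α n ^ 2) * l) =
        2 * ((1 - α n ^ 2) * L) * √(l / L / (1 - α n ^ 2)) := by
      have e1 : (2 * L) * (2 * (1 - α n ^ 2) * l) =
          (2 * ((1 - α n ^ 2) * L)) ^ 2 * (l / L / (1 - α n ^ 2)) := by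
        field_simp
      rw [← Real.sqrt_mul (by linarith), e1, Real.sqrt_mul (by positivity),
        Real.sqrt_sq (by positivity)]
    rw [h6, div_le_iff₀ (by linarith)]
    nlinarith [Real.sqrt_nonneg (l / L / (1 - α n ^ 2))]

theorem tendsto_rate
    (hlog : (fun n : ℕ => Real.log (Real.log (numFilters (α n) (β n) n)) /
        Real.log (numFilters (α n) (β n) n)) =o[atTop] fun n => 1 - α n ^ 2) :
    Tendsto (fun n => rate (α n) (β n) n) atTop (𝓝 0) := by
  have hlogn : Tendsto (fun n : ℕ => Real.log n) atTop atTop :=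
    Real.tendsto_log_atTop.comp tendsto_natCast_atTop_atTop
  have hL := tendsto_log_numFilters h
  have h1 : Tendsto (fun n : ℕ => Real.log 2 / Real.log n) atTop (𝓝 0) :=
    hlogn.const_div_atTop _
  have h2 := tendsto_crossTerm_div_log h hlog
  have h3 : Tendsto (fun n => Real.exp (-(√(Real.log (numFilters (α n) (β n) n)) /
      √(2 * Real.pi)))) atTop (𝓝 0) :=
    Real.tendsto_exp_neg_atTop_nhds_zero.comp
      ((Real.tendsto_sqrt_atTop.comp hL).atTop_div_const (by positivity))
  have h4 : Tendsto (fun n => Real.exp (-(Real.log (Real.log (numFilters (α n) (β n) n)) / 2)))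
      atTop (𝓝 0) :=
    Real.tendsto_exp_neg_atTop_nhds_zero.comp
      ((Real.tendsto_log_atTop.comp hL).atTop_div_const two_pos)
  have := (h1.add h2).add (h3.add h4)
  simp only [add_zero] at this
  refine this.congr fun n => ?_
  rw [rate, add_div]

end Asymptotics

/-- The first summand of `rate` turns the constant and the cross term into a power of n. The second,
meant for failure probabilities, is nonnegative and only enlarges the exponent, so one sequence
serves all claims. -/
theorem exp_le_rpow_rate {α β : ℝ} {n : ℕ} (hn : 0 < Real.log n) (hn0 : 0 < n) :
    Real.exp (rho α β * Real.log n + Real.log 2 + crossTerm α (numFilters α β n)) ≤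
      (n : ℝ) ^ (rho α β + rate α β n) := by
  rw [Real.rpow_def_of_pos (by exact_mod_cast hn0), Real.exp_le_exp, rate]
  have h1 : Real.log n * ((Real.log 2 + crossTerm α (numFilters α β n)) / Real.log n) =
      Real.log 2 + crossTerm α (numFilters α β n) := mul_div_cancel₀ _ hn.ne'
  rw [mul_add, mul_add, h1]
  have h2 : 0 ≤ Real.log n * (Real.exp (-(√(Real.log (numFilters α β n)) / √(2 * Real.pi))) +
      Real.exp (-(Real.log (Real.log (numFilters α β n)) / 2))) := by positivity
  linarith

theorem eventually_log_le_mul {c : ℝ} (hc : 0 < c) :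
    ∀ᶠ n : ℕ in atTop, Real.log n ≤ n * c := by
  have h := Real.isLittleO_log_id_atTop.bound hc
  filter_upwards [tendsto_natCast_atTop_atTop.eventually h] with n hn
  simp only [id, Real.norm_eq_abs, Nat.abs_cast] at hn
  linarith [le_abs_self (Real.log n)]

end Top1

/-! ### Assembly -/

theorem mainTheorem3 :
    ∃ C : ℝ, 0 < C ∧ ∀ α β : ℕ → ℝ,
      (∀ n, 0 < β n ∧ β n < α n ∧ α n < 1) →
      ((fun n => Top1.rho (α n) (β n)) =O[atTop] fun _ => (1 : ℝ)) →
      ((fun n : ℕ => (1 - α n ^ 2) * Real.sqrt (Real.log (Real.log n) / Real.log n))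
        =o[atTop] fun n => α n - β n) →
      ((fun n : ℕ => Real.log (Real.log (Top1.numFilters (α n) (β n) n)) /
          Real.log (Top1.numFilters (α n) (β n) n))
        =o[atTop] fun n => 1 - α n ^ 2) →
      -- preprocessing time, space and query time
      (∀ n : ℕ, 1 ≤ n → ∀ (d : ℕ) (S : Fin n → Top1.UnitSphere d) (ω : ℕ × ℕ → ℝ),
        ((Top1.build (α n) (β n) S ω).steps : ℝ) ≤
            C * (d * (n : ℝ) ^ (1 + Top1.rho (α n) (β n) / (1 - α n ^ 2))) ∧
        ((Top1.build (α n) (β n) S ω).val.space : ℝ) ≤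
            C * (d * (n : ℝ) ^ (Top1.rho (α n) (β n) / (1 - α n ^ 2))) ∧
        ∀ q : Top1.UnitSphere d,
          ((Top1.query (Top1.build (α n) (β n) S ω).val (β n) (Top1.coords q)).steps : ℝ) ≤
            C * (d * (n : ℝ) ^ (Top1.rho (α n) (β n) / (1 - α n ^ 2)))) ∧
      -- probabilities and expectations, uniformly in the dimension, the dataset and the query
      ∃ ε : ℕ → ℝ, Tendsto ε atTop (𝓝 0) ∧
        ∀ᶠ n : ℕ in atTop, ∀ (d : ℕ) (S : Fin n → Top1.UnitSphere d) (q : Top1.UnitSphere d),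
          -- the data structure solves the approximate near neighbor problem
          ((∃ k, α n ≤ Top1.sim q (S k)) →
            Top1.gaussianSource {ω | ¬ Top1.Succeeds (α n) (β n) S q ω} ≤
              ENNReal.ofReal (ε n)) ∧
          -- the expected number of inspected buckets
          (∫⁻ ω, (Top1.numInspected (α n) (β n) S q ω : ENNReal) ∂Top1.gaussianSource ≤
            ENNReal.ofReal ((n : ℝ) ^ (Top1.rho (α n) (β n) + ε n))) ∧
          -- the expected number of far points in the inspected buckets
          (∫⁻ ω, (Top1.numFar (α n) (β n) S q ω : ENNReal) ∂Top1.gaussianSource ≤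
            ENNReal.ofReal ((n : ℝ) ^ (Top1.rho (α n) (β n) + ε n))) ∧
          -- each close point is in an inspected bucket with high probability
          (∀ k, α n ≤ Top1.sim q (S k) →
            Top1.gaussianSource {ω | ¬ Top1.Inspected (α n) (β n) S q ω k} ≤
              ENNReal.ofReal (ε n)) := by
  refine ⟨100, by norm_num, fun α β h _ _ hlog => ⟨fun n hn d S ω => ?_, ?_⟩⟩
  · obtain ⟨hβ, hβα, hα⟩ := h n
    exact ⟨Top1.build_steps_le_rpow hβ hβα hα hn S ω, Top1.space_le_rpow hβ hβα hα hn S ω,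
      Top1.query_steps_le_rpow hβ hβα hα hn S ω⟩
  refine ⟨fun n => Top1.rate (α n) (β n) n, Top1.tendsto_rate h hlog, ?_⟩
  have hL := Top1.tendsto_log_numFilters h
  filter_upwards [eventually_ge_atTop 1,
    (Real.tendsto_log_atTop.comp tendsto_natCast_atTop_atTop).eventually_gt_atTop 0,
    hL.eventually_gt_atTop 0, (Real.tendsto_log_atTop.comp hL).eventually_ge_atTop 1,
    -- The constant 1/100 is the margin that the bound for close points requires.
    hlog.bound (show (0 : ℝ) < 1 / 100 by norm_num),
    Top1.eventually_log_le_mul (show 0 < 1 / √(2 * Real.pi) * Real.exp (-(0 + 1) ^ 2 / 2) by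
      positivity)] with n hn hlogn hLn hln hlogb hsmall d S q
  obtain ⟨hβ, hβα, hα⟩ := h n
  simp only [Function.comp_apply] at hlogn hln
  have hlL : 100 * Real.log (Real.log (Top1.numFilters (α n) (β n) n)) ≤
      (1 - α n ^ 2) * Real.log (Top1.numFilters (α n) (β n) n) := by
    have h1 : 0 < 1 - α n ^ 2 := by nlinarith
    rw [Real.norm_of_nonneg (div_nonneg (by linarith) hLn.le), Real.norm_of_nonneg h1.le,
      div_le_iff₀ hLn] at hlogb
    linarith
  have hclose : ∀ k, α n ≤ Top1.sim q (S k) →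
      Top1.gaussianSource {ω | ¬ Top1.Inspected (α n) (β n) S q ω k} ≤
        ENNReal.ofReal (Top1.rate (α n) (β n) n) := fun k hk => by
    refine (Top1.measure_not_inspected_le_exp hβ hβα hα hLn hln hlL S q k hk).trans
      (ENNReal.ofReal_le_ofReal (le_add_of_nonneg_left (div_nonneg ?_ hlogn.le)))
    exact add_nonneg (Real.log_nonneg one_le_two) (Top1.crossTerm_nonneg _ _)
  refine ⟨?_, ?_, ?_, hclose⟩
  · rintro ⟨k, hk⟩
    refine (measure_mono ?_).trans (hclose k hk)
    exact fun ω hω hi => hω (hi.succeeds (hβα.le.trans hk))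
  · exact (Top1.lintegral_numInspected_le_exp hβ hβα hα hn S q).trans
      (ENNReal.ofReal_le_ofReal (Top1.exp_le_rpow_rate hlogn hn))
  · exact (Top1.lintegral_numFar_le_exp hβ hβα hα hn hsmall S q).trans
      (ENNReal.ofReal_le_ofReal (Top1.exp_le_rpow_rate hlogn hn))
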